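/- Conventions. Composition is written in the order of application: $fg$ means first $f$, then $g$. \emph{Semigroups.} A semigroup $S$ is regular if every $a\in S$ satisfies $axa=a$ for some $x\in S$, and left reductive if the map $a\mapsto(x\mapsto xa)$ from $S$ to the self-maps of $S$ is injective. $\mathbf{LRS}$ is the category of left reductive regular semigroups and all semigroup homomorphisms. For a regular semigroup $S$ put $a\leqslant_r b\iff a\in bS$; the set $S/\mathscr{R}$ of classes of the associated equivalence $\mathscr{R}$ is a poset under $R_a\sqsubseteq R_b\iff a\leqslant_r b$. \emph{Normal categories.} A category with subobjects is a small category $\mathcal C$ with a wide subcategory, whose morphisms are called inclusions, that is a strict preorder (at most one inclusion between two objects; the only isomorphisms among inclusions are identities), such that inclusions are monomorphisms of $\mathcal C$, and $h$ is an inclusion whenever $hg$ and $g$ are. A retraction is a morphism $q$ with $jq=1$ for some inclusion $j$. A cone with vertex $z$ is a family $\gamma(c)\colon c\to z$, indexed by the objects $c$, with $j\gamma(b)=\gamma(a)$ for each inclusion $j\colon a\to b$ and with at least one $\gamma(c)$ an isomorphism. $\mathcal C$ is normal if every inclusion $j$ splits ($jq=1$ for some $q$), every morphism $f$ has a normal factorisation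 $f=quj$ ($q$ a retraction, $u$ an isomorphism, $j$ an inclusion), and every object $c$ is the vertex of a cone $\mu$ with $\mu(c)=1_c$. The epimorphism $f^\circ:=qu$ does not depend on the factorisation. For a cone $\gamma$ with vertex $z_\gamma$ and an epimorphism $p$ from $z_\gamma$, let $\gamma\ast p$ be the cone $c\mapsto\gamma(c)p$. The cones of $\mathcal C$ form a regular semigroup $\widehat{\mathcal C}$ under $\gamma\cdot\delta=\gamma\ast(\delta(z_\gamma))^\circ$. \emph{Connected categories.} A connected category $\mathcal C_{\mathfrak D}$ is a normal category $\mathcal C$ with a down-set $\mathfrak D$ of the poset $\widehat{\mathcal C}/\mathscr R$ such that every object $c$ is connected by some $\mathfrak d\in\mathfrak D$, that is, $\mathfrak d$ contains an idempotent cone with vertex $c$; this cone is unique and denoted $\epsilon(c,\mathfrak d)$. A CC-morphism $\mathcal C_{\mathfrak D}\to\mathcal C'_{\mathfrak D'}$ is a pair $(F,G)$ of an inclusion preserving functor $F\colon\mathcal C\to\mathcal C'$ and an order preserving map $G\colon\mathfrak D\to\mathfrak D'$ such that, whenever $c$ is connected by $\mathfrak d\in\mathfrak D$, the object $F(c)$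 is connected by $G(\mathfrak d)$ and $F(\epsilon(c,\mathfrak d)(c'))=\epsilon(F(c),G(\mathfrak d))(F(c'))$ for all objects $c'$ of $\mathcal C$. Connected categories and CC-morphisms form the category $\mathbf{CC}$. \emph{The functor $\mathtt C\colon\mathbf{LRS}\to\mathbf{CC}$.} For a regular semigroup $S$ let $\mathbb L(S)$ be the normal category whose objects are the principal left ideals $Se$ with $e\in S$ idempotent, whose morphisms $Se\to Sf$ are the maps $r(e,u,f)\colon x\mapsto xu$ with $u\in eSf$, and whose inclusions are the set inclusions. For $a\in S$ the principal cone $r^a$ has vertex $Sa$ and components $x\mapsto xa$. Let $\mathfrak R=\{R_{r^e}: e\in S \text{ idempotent}\}\subseteq\widehat{\mathbb L(S)}/\mathscr R$. Then $\mathtt C(S)=\mathbb L(S)_{\mathfrak R}$, and a homomorphism $\phi\colon S\to S'$ is sent to the CC-morphism $(F_\phi,G_\phi)$ with $F_\phi(Se)=S'(e\phi)$, $F_\phi(r(e,u,f))=r(e\phi,u\phi,f\phi)$, $G_\phi(R_{r^e})=R_{r^{e\phi}}$. \emph{The functor $\mathtt S\colon\mathbf{CC}\to\mathbf{LRS}$.}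 It sends $\mathcal C_{\mathfrak D}$ to its connection semigroup, the subsemigroup $\widehat{\mathcal C_{\mathfrak D}}=\{\gamma\in\widehat{\mathcal C}: R_\gamma\in\mathfrak D\}$ of $\widehat{\mathcal C}$, and a CC-morphism $(F,G)$ to the homomorphism $\epsilon(c,\mathfrak d)\ast u\mapsto\epsilon(F(c),G(\mathfrak d))\ast F(u)$ ($u$ an isomorphism); every element of the connection semigroup has the form $\epsilon(c,\mathfrak d)\ast u$. \textbf{Theorem.} The category $\mathbf{LRS}$ of left reductive regular semigroups is equivalent to the category $\mathbf{CC}$ of connected categories. More precisely, there is an equivalence of categories whose functor is $\mathtt C$ and whose inverse functor is $\mathtt S$; that is, $\mathtt C$ followed by $\mathtt S$ is naturally isomorphic to $1_{\mathbf{LRS}}$, and $\mathtt S$ followed by $\mathtt C$ is naturally isomorphic to $1_{\mathbf{CC}}$. -/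

import Mathlib

open CategoryTheory

universe u

namespace CrossConn

/-! ## Semigroups -/

section Semigroups

variable (S : Type u) [Semigroup S]

/-- A semigroup is (von Neumann) regular if every `a` satisfies `a x a = a` for some `x`. -/
class IsRegularSemigroup : Prop where
  regular : ∀ a : S, ∃ x : S, a * x * a = a

/-- A semigroup is left reductive if its regular representation
`a ↦ (x ↦ x a)` is injective. -/
def IsLeftReductive : Prop :=
  Function.Injective (fun a : S => fun x : S => x * a)

variable {S}

/-- The quasi-order `a ≤_r b ↔ a ∈ b S`. -/
def RLe (a b : S) : Prop := ∃ s : S, a = b * s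

theorem RLe.refl [IsRegularSemigroup S] (a : S) : RLe a a := by
  obtain ⟨x, hx⟩ := IsRegularSemigroup.regular a
  exact ⟨x * a, by rw [← mul_assoc, hx]⟩

theorem RLe.trans {a b c : S} (h : RLe a b) (k : RLe b c) : RLe a c := by
  obtain ⟨s, rfl⟩ := h
  obtain ⟨t, rfl⟩ := k
  exact ⟨t * s, by rw [mul_assoc]⟩

variable (S)

/-- Green's relation `R` of a regular semigroup. -/
def greenR [IsRegularSemigroup S] : Setoid S where
  r a b := RLe a b ∧ RLe b a
  iseqv :=
    { refl := fun a => ⟨RLe.refl a, RLe.refl a⟩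
      symm := fun h => ⟨h.2, h.1⟩
      trans := fun h k => ⟨h.1.trans k.1, k.2.trans h.2⟩ }

/-- The set `S / R` of `R`-classes of a regular semigroup. -/
def RClass [IsRegularSemigroup S] : Type u := Quotient (greenR S)

variable {S}

/-- The `R`-class of an element. -/
def rClass [IsRegularSemigroup S] (a : S) : RClass S := Quotient.mk (greenR S) a

/-- `S / R` is a poset: `R_a ⊑ R_b ↔ a ≤_r b`. -/
instance [IsRegularSemigroup S] : PartialOrder (RClass S) where
  le := Quotient.lift₂ (fun a b : S => RLe a b) (by
    intro a b a' b' h k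
    exact propext ⟨fun t => (h.2.trans t).trans k.1, fun t => (h.1.trans t).trans k.2⟩)
  le_refl := by
    rintro ⟨a⟩
    exact RLe.refl a
  le_trans := by
    rintro ⟨a⟩ ⟨b⟩ ⟨c⟩ h k
    exact RLe.trans h k
  le_antisymm := by
    rintro ⟨a⟩ ⟨b⟩ h k
    exact Quotient.sound ⟨h, k⟩

theorem rClass_le [IsRegularSemigroup S] {a b : S} : rClass a ≤ rClass b ↔ RLe a b := Iff.rfl

theorem rClass_eq [IsRegularSemigroup S] {a b : S} :
    rClass a = rClass b ↔ RLe a b ∧ RLe b a :=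
  ⟨fun h => ⟨rClass_le.1 h.le, rClass_le.1 h.ge⟩, fun h => le_antisymm h.1 h.2⟩

/-- In a regular semigroup every `R`-class contains an idempotent. -/
theorem exists_idem_rClass [IsRegularSemigroup S] (a : S) :
    ∃ e : S, IsIdempotentElem e ∧ rClass e = rClass a := by
  obtain ⟨x, hx⟩ := IsRegularSemigroup.regular a
  refine ⟨a * x, ?_, rClass_eq.2 ⟨⟨x, rfl⟩, ⟨a, hx.symm⟩⟩⟩
  show a * x * (a * x) = a * x
  rw [← mul_assoc, hx]

theorem IsIdempotentElem.mul_eq_of_rLe {e a : S} (he : IsIdempotentElem e) (h : RLe a e) :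
    e * a = a := by
  obtain ⟨s, rfl⟩ := h
  rw [← mul_assoc, he.eq]

end Semigroups

/-! ## Normal categories -/

/-- A small category with subobjects: a distinguished wide subcategory, whose morphisms are
called inclusions, which is a strict preorder, all of whose morphisms are monomorphisms of the
ambient category, and such that `h` is an inclusion whenever `h g` and `g` are. -/
class CategoryWithSubobjects (C : Type u) [SmallCategory C] where
  /-- The morphisms of the distinguished subcategory. -/
  Incl : MorphismProperty C
  incl_id : ∀ c : C, Incl (𝟙 c)
  incl_comp : ∀ {a b c : C} (f : a ⟶ b) (g : b ⟶ c), Incl f → Incl g → Incl (f ≫ g)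
  /-- There is at most one inclusion between two objects. -/
  incl_unique : ∀ {a b : C} (f g : a ⟶ b), Incl f → Incl g → f = g
  /-- The isomorphisms of the distinguished subcategory are identities
  (for `a = b` this follows from `incl_unique`). -/
  incl_strict : ∀ {a b : C} (f : a ⟶ b) (g : b ⟶ a), Incl f → Incl g →
    f ≫ g = 𝟙 a → g ≫ f = 𝟙 b → a = b
  incl_mono : ∀ {a b : C} (f : a ⟶ b), Incl f → Mono f
  incl_of_comp : ∀ {a b c : C} (h : a ⟶ b) (g : b ⟶ c), Incl (h ≫ g) → Incl g → Incl h

open CategoryWithSubobjects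

section Cones

variable {C : Type u} [SmallCategory C] [CategoryWithSubobjects C]

/-- A retraction is a right inverse (in the order of composition) of an inclusion. -/
def IsRetraction {a b : C} (q : a ⟶ b) : Prop :=
  ∃ j : b ⟶ a, Incl j ∧ j ≫ q = 𝟙 b

/-- A cone with vertex `z`. -/
structure ConeTo (z : C) where
  /-- The component at an object. -/
  comp : ∀ c : C, c ⟶ z
  incl_comp : ∀ {a b : C} (j : a ⟶ b), Incl j → j ≫ comp b = comp a
  exists_iso : ∃ c : C, IsIso (comp c)

variable (C) in
/-- The cones of a category with subobjects. -/
structure Cone where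
  /-- The vertex of the cone. -/
  vertex : C
  /-- The cone with this vertex. -/
  toConeTo : ConeTo vertex

/-- The component of a cone at an object. -/
abbrev Cone.comp (γ : Cone C) (c : C) : c ⟶ γ.vertex := γ.toConeTo.comp c

theorem ConeTo.ext_comp {z : C} {γ δ : ConeTo z} (h : ∀ c, γ.comp c = δ.comp c) : γ = δ := by
  cases γ; cases δ
  congr
  exact funext h

theorem Cone.ext_comp {z w : C} {γ : ConeTo z} {δ : ConeTo w} (h : z = w)
    (k : ∀ c, γ.comp c ≫ eqToHom h = δ.comp c) : (⟨z, γ⟩ : Cone C) = ⟨w, δ⟩ := by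
  subst h
  have : γ = δ := ConeTo.ext_comp fun c => by simpa using k c
  rw [this]

theorem Cone.comp_of_eq {γ δ : Cone C} (h : γ = δ) :
    ∃ k : γ.vertex = δ.vertex, ∀ c, γ.comp c ≫ eqToHom k = δ.comp c := by
  subst h
  exact ⟨rfl, fun c => by simp⟩

theorem incl_eqToHom {a b : C} (h : a = b) : Incl (eqToHom h) := by
  subst h
  exact incl_id a

theorem incl_antisymm {a b : C} {f : a ⟶ b} {g : b ⟶ a} (hf : Incl f) (hg : Incl g) : a = b :=
  incl_strict f g hf hg (incl_unique _ _ (incl_comp _ _ hf hg) (incl_id _))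
    (incl_unique _ _ (incl_comp _ _ hg hf) (incl_id _))

end Cones

/-- A normal category: a category with subobjects in which every inclusion splits, every
morphism has a normal factorisation (a retraction followed by an isomorphism followed by an
inclusion), and every object `c` is the vertex of a cone whose component at `c` is `1_c`. -/
class NormalCategory (C : Type u) [SmallCategory C] extends CategoryWithSubobjects C where
  split : ∀ {a b : C} (j : a ⟶ b), Incl j → ∃ q : b ⟶ a, j ≫ q = 𝟙 a
  normal_fact : ∀ {a b : C} (f : a ⟶ b), ∃ (a' b' : C) (q : a ⟶ a') (v : a' ⟶ b') (j : b' ⟶ b),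
    IsRetraction q ∧ IsIso v ∧ Incl j ∧ f = q ≫ v ≫ j
  exists_cone : ∀ c : C, ∃ μ : ConeTo c, μ.comp c = 𝟙 c

section Normal

variable {C : Type u} [SmallCategory C] [NormalCategory C]

theorem exists_canonical_fact {a b : C} (f : a ⟶ b) :
    ∃ (i : C) (p : a ⟶ i) (j : i ⟶ b),
      (∃ (c : C) (q : a ⟶ c) (v : c ⟶ i), IsRetraction q ∧ IsIso v ∧ p = q ≫ v) ∧
        Incl j ∧ p ≫ j = f := by
  obtain ⟨a', b', q, v, j, hq, hv, hj, rfl⟩ := NormalCategory.normal_fact f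
  exact ⟨b', q ≫ v, j, ⟨a', q, v, hq, hv, rfl⟩, hj, by simp⟩

/-- The image of a morphism. -/
noncomputable def im {a b : C} (f : a ⟶ b) : C :=
  (exists_canonical_fact f).choose

/-- The epimorphic component `f°` of a morphism `f`: the part `q v` of a normal factorisation
`f = q v j`; it does not depend on the factorisation, see `canonical_unique`. -/
noncomputable def epiPart {a b : C} (f : a ⟶ b) : a ⟶ im f :=
  (exists_canonical_fact f).choose_spec.choose

/-- The inclusion of a morphism. -/
noncomputable def inclPart {a b : C} (f : a ⟶ b) : im f ⟶ b :=
  (exists_canonical_fact f).choose_spec.choose_spec.choose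

theorem epiPart_fact {a b : C} (f : a ⟶ b) :
    ∃ (c : C) (q : a ⟶ c) (v : c ⟶ im f), IsRetraction q ∧ IsIso v ∧ epiPart f = q ≫ v :=
  (exists_canonical_fact f).choose_spec.choose_spec.choose_spec.1

theorem inclPart_incl {a b : C} (f : a ⟶ b) : Incl (inclPart f) :=
  (exists_canonical_fact f).choose_spec.choose_spec.choose_spec.2.1

theorem epiPart_inclPart {a b : C} (f : a ⟶ b) : epiPart f ≫ inclPart f = f :=
  (exists_canonical_fact f).choose_spec.choose_spec.choose_spec.2.2

theorem IsRetraction.epi {a b : C} {q : a ⟶ b} (h : IsRetraction q) : Epi q := by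
  obtain ⟨j, -, hj⟩ := h
  exact ⟨fun f g hfg => by
    rw [← Category.id_comp f, ← Category.id_comp g, ← hj, Category.assoc, Category.assoc, hfg]⟩

instance epiPart_epi {a b : C} (f : a ⟶ b) : Epi (epiPart f) := by
  obtain ⟨c, q, v, hq, hv, h⟩ := epiPart_fact f
  rw [h]
  have := hq.epi
  exact epi_comp _ _

theorem canonical_unique_aux {a b w w' : C} {p : a ⟶ w} {j : w ⟶ b} {p' : a ⟶ w'} {j' : w' ⟶ b}
    (hp : Epi p) (hj : Incl j) (hj' : Incl j') (h : p ≫ j = p' ≫ j') :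
    ∃ k : w ⟶ w', Incl k ∧ p ≫ k = p' := by
  obtain ⟨s, hs⟩ := NormalCategory.split j' hj'
  have h1 : p ≫ (j ≫ s) = p' := by
    rw [← Category.assoc, h, Category.assoc, hs, Category.comp_id]
  refine ⟨j ≫ s, ?_, h1⟩
  have h2 : (j ≫ s) ≫ j' = j := by
    rw [← cancel_epi p, ← Category.assoc, h1, h]
  exact incl_of_comp _ j' (by rw [h2]; exact hj) hj'

/-- Uniqueness of canonical factorisations. -/
theorem canonical_unique {a b w w' : C} {p : a ⟶ w} {j : w ⟶ b} {p' : a ⟶ w'} {j' : w' ⟶ b}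
    (hp : Epi p) (hj : Incl j) (hp' : Epi p') (hj' : Incl j') (h : p ≫ j = p' ≫ j') :
    ∃ k : w = w', p ≫ eqToHom k = p' := by
  obtain ⟨k, hk, hpk⟩ := canonical_unique_aux hp hj hj' h
  obtain ⟨l, hl, -⟩ := canonical_unique_aux hp' hj' hj h.symm
  have e := incl_antisymm hk hl
  exact ⟨e, by rw [← hpk, incl_unique _ _ (incl_eqToHom e) hk]⟩

/-- The cone `γ ∗ p`, for an epimorphism `p` from the vertex of the cone `γ`. -/
def ConeTo.star {z w : C} (γ : ConeTo z) (p : z ⟶ w) (hp : Epi p) : ConeTo w where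
  comp c := γ.comp c ≫ p
  incl_comp j hj := by rw [← Category.assoc, γ.incl_comp j hj]
  exists_iso := by
    obtain ⟨c, hc⟩ := γ.exists_iso
    obtain ⟨z', w', q, v, j, ⟨i, hi, hiq⟩, hv, hj, rfl⟩ := NormalCategory.normal_fact p
    have hje : Epi j := by
      have := hp
      have : Epi ((q ≫ v) ≫ j) := by simpa using hp
      exact epi_of_epi (q ≫ v) j
    have hjiso : IsIso j := by
      obtain ⟨s, hs⟩ := NormalCategory.split j hj
      exact ⟨s, hs, by rw [← cancel_epi j, ← Category.assoc, hs]; simp⟩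
    obtain ⟨c', c'', q', v', k, ⟨i', hi', hiq'⟩, hv', hk, hf⟩ :=
      NormalCategory.normal_fact (i ≫ inv (γ.comp c))
    have hm : Mono i := incl_mono i hi
    have hq'm : IsIso q' := by
      have : Mono (q' ≫ v' ≫ k) := by rw [← hf]; exact mono_comp _ _
      have : Mono q' := mono_of_mono q' (v' ≫ k)
      exact ⟨i', by rw [← cancel_mono q', Category.assoc, hiq']; simp, hiq'⟩
    refine ⟨c'', ?_⟩
    have e : γ.comp c'' ≫ q = inv (q' ≫ v') := by
      rw [← cancel_epi (q' ≫ v'), IsIso.hom_inv_id, ← γ.incl_comp k hk]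
      have : (q' ≫ v') ≫ (k ≫ γ.comp c) ≫ q = (q' ≫ v' ≫ k) ≫ γ.comp c ≫ q := by simp
      rw [this, ← hf]
      simp [hiq]
    rw [show γ.comp c'' ≫ q ≫ v ≫ j = (γ.comp c'' ≫ q) ≫ v ≫ j by simp, e]
    infer_instance

theorem ConeTo.star_congr {z w w' : C} (γ : ConeTo z) {p : z ⟶ w} {p' : z ⟶ w'} (hp : Epi p)
    (hp' : Epi p') (h : w = w') (k : p ≫ eqToHom h = p') :
    (⟨w, γ.star p hp⟩ : Cone C) = ⟨w', γ.star p' hp'⟩ :=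
  Cone.ext_comp h fun c => by
    show (γ.comp c ≫ p) ≫ eqToHom h = γ.comp c ≫ p'
    rw [Category.assoc, k]

/-- The product `γ · δ = γ ∗ (δ(z_γ))°` of cones. -/
noncomputable instance : Mul (Cone C) where
  mul γ δ := ⟨im (δ.comp γ.vertex), γ.toConeTo.star (epiPart (δ.comp γ.vertex)) inferInstance⟩

theorem cone_mul_def (γ δ : Cone C) : γ * δ =
    ⟨im (δ.comp γ.vertex), γ.toConeTo.star (epiPart (δ.comp γ.vertex)) inferInstance⟩ := rfl

theorem cone_mul_eq (γ δ : Cone C) {w : C} (p : γ.vertex ⟶ w) (j : w ⟶ δ.vertex) (hp : Epi p)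
    (hj : Incl j) (h : p ≫ j = δ.comp γ.vertex) : γ * δ = ⟨w, γ.toConeTo.star p hp⟩ := by
  obtain ⟨k, hk⟩ := canonical_unique (epiPart_epi (δ.comp γ.vertex))
    (inclPart_incl (δ.comp γ.vertex)) hp hj (by rw [epiPart_inclPart, h])
  exact ConeTo.star_congr _ _ _ k hk

/-- The cones of a normal category form a semigroup. -/
noncomputable instance : Semigroup (Cone C) where
  mul_assoc γ δ η := by
    have hx : inclPart (δ.comp γ.vertex) ≫ η.comp δ.vertex = η.comp (im (δ.comp γ.vertex)) :=
      η.toConeTo.incl_comp _ (inclPart_incl _)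
    let x := inclPart (δ.comp γ.vertex) ≫ epiPart (η.comp δ.vertex)
    have hx1 : γ * δ * η = ⟨im x, (γ * δ).toConeTo.star (epiPart x) inferInstance⟩ :=
      cone_mul_eq (γ * δ) η (epiPart x) (inclPart x ≫ inclPart (η.comp δ.vertex)) _
        (incl_comp _ _ (inclPart_incl _) (inclPart_incl _)) (by
          rw [← Category.assoc, epiPart_inclPart]
          show (_ ≫ _) ≫ _ = η.comp (im (δ.comp γ.vertex))
          rw [Category.assoc, epiPart_inclPart, hx])
    have hx2 : γ * (δ * η) = ⟨im x, γ.toConeTo.star (epiPart (δ.comp γ.vertex) ≫ epiPart x)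
        (epi_comp _ _)⟩ :=
      cone_mul_eq γ (δ * η) _ (inclPart x) _ (inclPart_incl _) (by
        rw [Category.assoc, epiPart_inclPart, ← Category.assoc, epiPart_inclPart]
        rfl)
    rw [hx1, hx2]
    refine Cone.ext_comp rfl fun c => ?_
    show ((γ.comp c ≫ epiPart (δ.comp γ.vertex)) ≫ epiPart x) ≫ 𝟙 _ = _
    simp [ConeTo.star]

theorem cone_mul_of_epi (γ δ : Cone C) (h : Epi (δ.comp γ.vertex)) :
    γ * δ = ⟨δ.vertex, γ.toConeTo.star (δ.comp γ.vertex) h⟩ :=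
  cone_mul_eq γ δ _ (𝟙 _) h (incl_id _) (by simp)

theorem cone_idem_iff {z : C} (γ : ConeTo z) :
    IsIdempotentElem (⟨z, γ⟩ : Cone C) ↔ γ.comp z = 𝟙 z := by
  constructor
  · intro h
    obtain ⟨k, hk⟩ := Cone.comp_of_eq h
    have hj : inclPart (γ.comp z) = eqToHom k :=
      incl_unique _ _ (inclPart_incl _) (incl_eqToHom k)
    obtain ⟨c, hc⟩ := γ.exists_iso
    have h1 : γ.comp c ≫ γ.comp z = γ.comp c := by
      have := hk c
      rw [← hj] at this
      change (γ.comp c ≫ epiPart (γ.comp z)) ≫ inclPart (γ.comp z) = γ.comp c at this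
      rwa [Category.assoc, epiPart_inclPart] at this
    rw [← cancel_epi (γ.comp c), h1, Category.comp_id]
  · intro h
    have he : Epi (γ.comp z) := by rw [h]; infer_instance
    show _ * _ = _
    rw [cone_mul_of_epi _ _ he]
    refine Cone.ext_comp rfl fun c => ?_
    show (γ.comp c ≫ γ.comp z) ≫ 𝟙 _ = _
    rw [h, Category.comp_id, Category.comp_id]

theorem exists_iso_comp_mul (γ χ : Cone C) (d : C) (hd : IsIso (γ.comp d)) (μ : ConeTo γ.vertex)
    (hμ : μ.comp γ.vertex = 𝟙 _) (hχ : χ = ⟨d, μ.star (inv (γ.comp d)) inferInstance⟩) :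
    γ * χ * γ = γ := by
  subst hχ
  have h1 : μ.comp γ.vertex ≫ inv (γ.comp d) = inv (γ.comp d) := by rw [hμ, Category.id_comp]
  rw [cone_mul_eq γ _ (inv (γ.comp d)) (𝟙 d) inferInstance (incl_id _)
    (by rw [Category.comp_id]; exact h1.symm)]
  rw [cone_mul_of_epi _ γ (by change Epi (γ.comp d); infer_instance)]
  refine Cone.ext_comp rfl fun c => ?_
  show ((γ.comp c ≫ inv (γ.comp d)) ≫ γ.comp d) ≫ 𝟙 _ = _
  simp

/-- The semigroup of cones of a normal category is regular. -/
instance : IsRegularSemigroup (Cone C) where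
  regular γ := by
    obtain ⟨d, hd⟩ := γ.toConeTo.exists_iso
    obtain ⟨μ, hμ⟩ := NormalCategory.exists_cone γ.vertex
    exact ⟨_, exists_iso_comp_mul γ _ d hd μ hμ rfl⟩

theorem cone_rLe_iff (γ δ : Cone C) : RLe γ δ ↔
    ∃ (p : δ.vertex ⟶ γ.vertex) (_ : Epi p), ∀ c, γ.comp c = δ.comp c ≫ p := by
  constructor
  · rintro ⟨η, rfl⟩
    exact ⟨epiPart (η.comp δ.vertex), inferInstance, fun c => rfl⟩
  · rintro ⟨p, hp, h⟩
    obtain ⟨μ, hμ⟩ := NormalCategory.exists_cone δ.vertex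
    refine ⟨⟨γ.vertex, μ.star p hp⟩, ?_⟩
    rw [cone_mul_eq δ ⟨γ.vertex, μ.star p hp⟩ p (𝟙 _) hp (incl_id _) (by
      show p ≫ 𝟙 _ = μ.comp δ.vertex ≫ p
      rw [hμ, Category.comp_id, Category.id_comp])]
    exact Cone.ext_comp rfl fun c => by simpa [ConeTo.star] using h c

/-- The `R`-class `d` contains the idempotent cone `ε` with vertex `c`. -/
def IsConnector {c : C} (d : RClass (Cone C)) (ε : ConeTo c) : Prop :=
  IsIdempotentElem (⟨c, ε⟩ : Cone C) ∧ rClass (⟨c, ε⟩ : Cone C) = d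

/-- The object `c` is connected by `d`: the `R`-class `d` contains an idempotent cone with
vertex `c`. -/
def ConnectedBy (c : C) (d : RClass (Cone C)) : Prop :=
  ∃ ε : ConeTo c, IsConnector d ε

/-- There is at most one idempotent cone with a given vertex in a given `R`-class. -/
theorem IsConnector.unique {c : C} {d : RClass (Cone C)} {ε ε' : ConeTo c}
    (h : IsConnector d ε) (h' : IsConnector d ε') : ε = ε' := by
  obtain ⟨p, -, hp⟩ := (cone_rLe_iff _ _).1 (rClass_eq.1 (h.2.trans h'.2.symm)).1
  have h1 := (cone_idem_iff ε).1 h.1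
  have h2 := (cone_idem_iff ε').1 h'.1
  have h3 : p = 𝟙 c := by
    have := hp c
    change ε.comp c = ε'.comp c ≫ p at this
    rw [h1, h2, Category.id_comp] at this
    exact this.symm
  refine ConeTo.ext_comp fun x => ?_
  have := hp x
  rw [h3] at this
  exact this.trans (Category.comp_id _)

/-- The idempotent cone `ε(c, d)` with vertex `c` in the `R`-class `d`. -/
noncomputable def idemCone {c : C} {d : RClass (Cone C)} (h : ConnectedBy c d) : ConeTo c :=
  h.choose

theorem idemCone_spec {c : C} {d : RClass (Cone C)} (h : ConnectedBy c d) :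
    IsConnector d (idemCone h) :=
  h.choose_spec

theorem exists_connectedBy (d : RClass (Cone C)) : ∃ c : C, ConnectedBy c d := by
  obtain ⟨γ, rfl⟩ := Quotient.exists_rep d
  obtain ⟨⟨c, ε⟩, h1, h2⟩ := exists_idem_rClass γ
  exact ⟨c, ε, h1, h2⟩

end Normal

/-! ## Connected categories -/

/-- A connected category: a normal category `C` with a down-set `D` of the poset of
`R`-classes of its semigroup of cones such that every object of `C` is connected by some
member of `D`. -/
structure ConnectedCategory : Type (u + 1) where
  /-- The objects of the normal category. -/
  C : Type u
  [cat : SmallCategory C]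
  [normal : NormalCategory C]
  /-- The down-set. -/
  D : LowerSet (RClass (Cone C))
  connects : ∀ c : C, ∃ d ∈ D, ConnectedBy c d

attribute [instance] ConnectedCategory.cat ConnectedCategory.normal

/-- A CC-morphism: an inclusion preserving functor `F` and an order preserving map `G` such
that, if `c` is connected by `d`, then `F c` is connected by `G d` and
`F (ε(c, d)(x)) = ε(F c, G d)(F x)` for all objects `x`. -/
@[ext]
structure CCMorphism (X Y : ConnectedCategory.{u}) where
  /-- The functor. -/
  F : X.C ⥤ Y.C
  /-- The map of down-sets. -/
  G : {d // d ∈ X.D} →o {d // d ∈ Y.D}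
  map_incl : ∀ {a b : X.C} (j : a ⟶ b), Incl j → Incl (F.map j)
  map_connected : ∀ {c : X.C} (d : {d // d ∈ X.D}),
    ConnectedBy c d.1 → ConnectedBy (F.obj c) (G d).1
  map_cone : ∀ {c : X.C} (d : {d // d ∈ X.D}) (h : ConnectedBy c d.1) (x : X.C),
    F.map ((idemCone h).comp x) = (idemCone (map_connected d h)).comp (F.obj x)

/-- The category `CC` of connected categories and CC-morphisms. -/
noncomputable instance : Category ConnectedCategory.{u} where
  Hom := CCMorphism
  id X :=
    { F := 𝟭 X.C
      G := OrderHom.id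
      map_incl := fun _ hj => hj
      map_connected := fun _ h => h
      map_cone := fun _ _ _ => rfl }
  comp m n :=
    { F := m.F ⋙ n.F
      G := n.G.comp m.G
      map_incl := fun j hj => n.map_incl _ (m.map_incl j hj)
      map_connected := fun d h => n.map_connected _ (m.map_connected d h)
      map_cone := fun d h x => by
        show n.F.map (m.F.map _) = _
        rw [m.map_cone d h x]
        exact n.map_cone (m.G d) (m.map_connected d h) (m.F.obj x) }

/-! ## Left reductive regular semigroups -/

/-- The category `LRS`: the full subcategory of the category of semigroups on the left
reductive regular semigroups. -/
abbrev LRS : Type (u + 1) :=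
  ObjectProperty.FullSubcategory
    (fun S : Semigrp.{u} => IsRegularSemigroup S ∧ IsLeftReductive S)

/-! ## The connection semigroup -/

section ConnectionSemigroup

theorem rClass_mul_le {S : Type u} [Semigroup S] [IsRegularSemigroup S] (a b : S) :
    rClass (a * b) ≤ rClass a :=
  rClass_le.2 ⟨b, rfl⟩

/-- The connection semigroup: the cones whose `R`-class lies in the down-set. -/
noncomputable def connectionSemigroup (X : ConnectedCategory.{u}) : Subsemigroup (Cone X.C) where
  carrier := {γ | rClass γ ∈ X.D}
  mul_mem' {a b} ha _ := X.D.lower (rClass_mul_le a b) ha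

variable (X : ConnectedCategory.{u})

theorem exists_idem_vertex (c : X.C) :
    ∃ ε : ConeTo c, ε.comp c = 𝟙 c ∧ (⟨c, ε⟩ : Cone X.C) ∈ connectionSemigroup X := by
  obtain ⟨d, hd, ε, h1, h2⟩ := X.connects c
  exact ⟨ε, (cone_idem_iff ε).1 h1, by show rClass _ ∈ X.D; rw [h2]; exact hd⟩

theorem star_mem_connectionSemigroup {z w : X.C} (γ : ConeTo z) (p : z ⟶ w) (hp : Epi p)
    (h : (⟨z, γ⟩ : Cone X.C) ∈ connectionSemigroup X) :
    (⟨w, γ.star p hp⟩ : Cone X.C) ∈ connectionSemigroup X :=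
  X.D.lower (rClass_le.2 ((cone_rLe_iff _ _).2 ⟨p, hp, fun _ => rfl⟩)) h

instance connectionSemigroup_regular : IsRegularSemigroup (connectionSemigroup X) where
  regular := by
    rintro ⟨γ, hγ⟩
    obtain ⟨d, hd⟩ := γ.toConeTo.exists_iso
    obtain ⟨μ, hμ, hμX⟩ := exists_idem_vertex X γ.vertex
    refine ⟨⟨_, star_mem_connectionSemigroup X μ (inv (γ.comp d)) inferInstance hμX⟩, ?_⟩
    exact Subtype.ext (exists_iso_comp_mul γ _ d hd μ hμ rfl)

theorem connectionSemigroup_leftReductive : IsLeftReductive (connectionSemigroup X) := by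
  intro γ δ h
  have key : ∀ η : connectionSemigroup X, η.1 * γ.1 = η.1 * δ.1 := fun η =>
    congrArg Subtype.val (congrFun h η)
  have aux : ∀ α β : connectionSemigroup X, (∀ η : connectionSemigroup X, η.1 * α.1 = η.1 * β.1) →
      ∃ j : α.1.vertex ⟶ β.1.vertex, Incl j := by
    intro α β hαβ
    obtain ⟨x, hx⟩ := IsRegularSemigroup.regular α
    have h1 : α.1 = (α * x).1 * β.1 := by
      rw [← hαβ]
      exact congrArg Subtype.val hx.symm
    obtain ⟨k, -⟩ := Cone.comp_of_eq h1
    exact ⟨eqToHom k ≫ inclPart _, incl_comp _ _ (incl_eqToHom k) (inclPart_incl _)⟩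
  obtain ⟨j, hj⟩ := aux γ δ key
  obtain ⟨j', hj'⟩ := aux δ γ fun η => (key η).symm
  have e := incl_antisymm hj hj'
  refine Subtype.ext (Cone.ext_comp e fun c => ?_)
  obtain ⟨ε, hε, hεX⟩ := exists_idem_vertex X c
  obtain ⟨k, hk⟩ := Cone.comp_of_eq (key ⟨_, hεX⟩)
  have h1 := hk c
  change (ε.comp c ≫ epiPart (γ.1.comp c)) ≫ eqToHom k = ε.comp c ≫ epiPart (δ.1.comp c) at h1
  rw [hε, Category.id_comp, Category.id_comp] at h1
  show γ.1.comp c ≫ _ = δ.1.comp c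
  rw [← epiPart_inclPart (δ.1.comp c), ← h1, Category.assoc]
  conv_lhs => rw [← epiPart_inclPart (γ.1.comp c), Category.assoc]
  congr 1
  exact incl_unique _ _ (incl_comp _ _ (inclPart_incl _) (incl_eqToHom e))
    (incl_comp _ _ (incl_eqToHom k) (inclPart_incl _))

/-- The connection semigroup as an object of `LRS`. -/
noncomputable def connectionLRS : LRS.{u} :=
  ⟨Semigrp.of (connectionSemigroup X),
    connectionSemigroup_regular X, connectionSemigroup_leftReductive X⟩

end ConnectionSemigroup

section ConnectionMap

/-- If the idempotent cone `ε` with vertex `c` is `R`-related to `γ`, then `γ = ε ∗ γ(c)`, and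
`γ(c)` is an isomorphism. -/
theorem comp_of_isConnector {C : Type u} [SmallCategory C] [NormalCategory C] {c : C} (γ : Cone C)
    {ε : ConeTo c} (h : IsConnector (rClass γ) ε) :
    IsIso (γ.comp c) ∧ ∀ x, γ.comp x = ε.comp x ≫ γ.comp c := by
  have h1 := (cone_idem_iff ε).1 h.1
  obtain ⟨h2, h3⟩ := rClass_eq.1 h.2
  obtain ⟨p, -, hp⟩ := (cone_rLe_iff _ _).1 h3
  obtain ⟨q, -, hq⟩ := (cone_rLe_iff _ _).1 h2
  have h4 : γ.comp c = p := by
    have := hp c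
    change _ = ε.comp c ≫ p at this
    rwa [h1, Category.id_comp] at this
  have h5 : p ≫ q = 𝟙 c := by
    rw [← h4]
    exact (hq c).symm.trans h1
  have h6 : q ≫ p = 𝟙 γ.vertex := by
    obtain ⟨x, hx⟩ := γ.toConeTo.exists_iso
    rw [← cancel_epi (γ.comp x), ← Category.assoc, ← hq x, Category.comp_id]
    exact (hp x).symm
  rw [h4]
  exact ⟨⟨q, h5, h6⟩, hp⟩

theorem exists_star_rep {X : ConnectedCategory.{u}} (γ : connectionSemigroup X) :
    ∃ (c : X.C) (_ : ConnectedBy c (rClass γ.1)), IsIso (γ.1.comp c) := by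
  obtain ⟨c, h⟩ := exists_connectedBy (rClass γ.1)
  exact ⟨c, h, (comp_of_isConnector γ.1 (idemCone_spec h)).1⟩

variable {X Y : ConnectedCategory.{u}} (m : CCMorphism X Y)

/-- The cone `ε(F c, G d) ∗ F v`, for `ε(c, d)` in the connection semigroup and an isomorphism
`v` from `c`. -/
noncomputable def mapStar {c z : X.C} (d : {d // d ∈ X.D}) (h : ConnectedBy c d.1) (v : c ⟶ z)
    (hv : IsIso v) : Cone Y.C :=
  ⟨m.F.obj z, (idemCone (m.map_connected d h)).star (m.F.map v) inferInstance⟩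

/-- The map `ε(c, d) ∗ v ↦ ε(F c, G d) ∗ F v` (with `v` an isomorphism) on cones; see
`connectionFun_star` for its independence of the representation. -/
noncomputable def connectionFun (γ : connectionSemigroup X) : Cone Y.C :=
  mapStar m ⟨rClass γ.1, γ.2⟩ (exists_star_rep γ).choose_spec.choose
    (γ.1.comp (exists_star_rep γ).choose) (exists_star_rep γ).choose_spec.choose_spec

theorem mapStar_rClass {c z : X.C} (d : {d // d ∈ X.D}) (h : ConnectedBy c d.1) (v : c ⟶ z)
    (hv : IsIso v) : rClass (mapStar m d h v hv) = (m.G d).1 := by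
  have h1 := idemCone_spec (m.map_connected d h)
  have hFv : IsIso (m.F.map v) := inferInstance
  have hFe : Epi (m.F.map v) := inferInstance
  rw [← h1.2]
  refine rClass_eq.2 ⟨(cone_rLe_iff _ _).2 ⟨m.F.map v, hFe, fun _ => rfl⟩,
    (cone_rLe_iff _ _).2 ⟨@inv _ _ _ _ (m.F.map v) hFv,
      @IsIso.epi_of_iso _ _ _ _ _ (@IsIso.inv_isIso _ _ _ _ _ hFv), fun x => ?_⟩⟩
  show _ = ((idemCone (m.map_connected d h)).comp x ≫ m.F.map v) ≫ inv (m.F.map v)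
  rw [Category.assoc, IsIso.hom_inv_id, Category.comp_id]

/-- If `γ = ε(c, d) ∗ p` with `p` an epimorphism, then the image of `γ` is
`ε(F c, G d) ∗ F p`. -/
theorem connectionFun_eq_star {c z : X.C} (d : {d // d ∈ X.D}) (h : ConnectedBy c d.1)
    (p : c ⟶ z) (hp : Epi p) (hX : (⟨z, (idemCone h).star p hp⟩ : Cone X.C) ∈ connectionSemigroup X)
    (hFp : Epi (m.F.map p)) :
    connectionFun m ⟨_, hX⟩ =
      ⟨m.F.obj z, (idemCone (m.map_connected d h)).star (m.F.map p) hFp⟩ := by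
  let γ : connectionSemigroup X := ⟨_, hX⟩
  obtain ⟨b, hb, hv, hγ⟩ : ∃ (b : X.C) (hb : ConnectedBy b (rClass γ.1))
    (hv : IsIso (γ.1.comp b)), connectionFun m γ =
      mapStar m ⟨rClass γ.1, γ.2⟩ hb (γ.1.comp b) hv := ⟨_, _, _, rfl⟩
  refine hγ.trans (Cone.ext_comp rfl fun x => ?_)
  have hle : (⟨rClass γ.1, γ.2⟩ : {d // d ∈ X.D}) ≤ d := by
    show rClass γ.1 ≤ d.1
    rw [← (idemCone_spec h).2]
    exact rClass_le.2 ((cone_rLe_iff _ _).2 ⟨p, hp, fun _ => rfl⟩)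
  have hle' : (m.G ⟨rClass γ.1, γ.2⟩).1 ≤ (m.G d).1 := m.G.monotone hle
  have s1 := idemCone_spec (m.map_connected d h)
  have s2 := idemCone_spec (m.map_connected ⟨rClass γ.1, γ.2⟩ hb)
  rw [← s1.2, ← s2.2] at hle'
  obtain ⟨q, -, hq⟩ := (cone_rLe_iff _ _).1 (rClass_le.1 hle')
  have hqc := hq (m.F.obj c)
  change (idemCone (m.map_connected ⟨rClass γ.1, γ.2⟩ hb)).comp (m.F.obj c) =
    (idemCone (m.map_connected d h)).comp (m.F.obj c) ≫ q at hqc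
  rw [(cone_idem_iff _).1 s1.1, Category.id_comp] at hqc
  rw [← m.map_cone ⟨rClass γ.1, γ.2⟩ hb] at hqc
  have hγc : (idemCone hb).comp c ≫ γ.1.comp b = p := by
    rw [← (comp_of_isConnector γ.1 (idemCone_spec hb)).2 c]
    show (idemCone h).comp c ≫ p = p
    rw [(cone_idem_iff _).1 (idemCone_spec h).1, Category.id_comp]
  show ((idemCone (m.map_connected ⟨rClass γ.1, γ.2⟩ hb)).comp x ≫ m.F.map (γ.1.comp b)) ≫ 𝟙 _ =
    (idemCone (m.map_connected d h)).comp x ≫ m.F.map p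
  have hqx := hq x
  change (idemCone (m.map_connected ⟨rClass γ.1, γ.2⟩ hb)).comp x =
    (idemCone (m.map_connected d h)).comp x ≫ q at hqx
  rw [hqx, ← hqc, Category.comp_id, Category.assoc, ← m.F.map_comp, hγc]

/-- The map on cones does not depend on the representation `γ = ε(c, d) ∗ v`. -/
theorem connectionFun_star {c z : X.C} (d : {d // d ∈ X.D}) (h : ConnectedBy c d.1)
    (v : c ⟶ z) (hv : IsIso v)
    (hX : (⟨z, (idemCone h).star v inferInstance⟩ : Cone X.C) ∈ connectionSemigroup X) :
    connectionFun m ⟨_, hX⟩ = mapStar m d h v hv :=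
  connectionFun_eq_star m d h v _ hX _

theorem connectionFun_mem (γ : connectionSemigroup X) :
    connectionFun m γ ∈ connectionSemigroup Y := by
  show rClass _ ∈ Y.D
  unfold connectionFun
  rw [mapStar_rClass]
  exact (m.G _).2

theorem map_isRetraction {a b : X.C} {q : a ⟶ b} (h : IsRetraction q) :
    IsRetraction (m.F.map q) := by
  obtain ⟨j, hj, hjq⟩ := h
  exact ⟨m.F.map j, m.map_incl j hj, by rw [← m.F.map_comp, hjq, m.F.map_id]⟩

/-- An inclusion preserving functor maps epimorphic components to epimorphisms. -/
theorem map_epiPart_epi {a b : X.C} (f : a ⟶ b) : Epi (m.F.map (epiPart f)) := by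
  obtain ⟨c, q, v, hq, hv, h⟩ := epiPart_fact f
  rw [h, m.F.map_comp]
  have := (map_isRetraction m hq).epi
  exact epi_comp _ _

theorem exists_cone_eq_star (γ : connectionSemigroup X) :
    ∃ (c z : X.C) (d : {d // d ∈ X.D}) (h : ConnectedBy c d.1) (v : c ⟶ z) (_ : IsIso v),
      γ.1 = ⟨z, (idemCone h).star v inferInstance⟩ := by
  obtain ⟨c, h, hv⟩ := exists_star_rep γ
  refine ⟨c, _, ⟨rClass γ.1, γ.2⟩, h, γ.1.comp c, hv, Cone.ext_comp rfl fun x => ?_⟩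
  show γ.1.comp x ≫ 𝟙 _ = (idemCone h).comp x ≫ γ.1.comp c
  rw [Category.comp_id]
  exact (comp_of_isConnector γ.1 (idemCone_spec h)).2 x

theorem connectionFun_mul (γ δ : connectionSemigroup X) :
    connectionFun m (γ * δ) = connectionFun m γ * connectionFun m δ := by
  obtain ⟨c, z, d, h, v, hv, hγ⟩ := exists_cone_eq_star γ
  obtain ⟨c', z', d', h', v', hv', hδ⟩ := exists_cone_eq_star δ
  obtain ⟨γ, hγX⟩ := γ
  obtain ⟨δ, hδX⟩ := δ
  subst hγ hδ
  rw [connectionFun_star m d h v hv, connectionFun_star m d' h' v' hv']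
  let f : z ⟶ z' := (idemCone h').comp z ≫ v'
  have hp : Epi (v ≫ epiPart f) := epi_comp _ _
  have hF := map_epiPart_epi m f
  have hFp : Epi (m.F.map (v ≫ epiPart f)) := by
    rw [m.F.map_comp]
    exact epi_comp _ _
  have e : (⟨z, (idemCone h).star v inferInstance⟩ : Cone X.C) *
      ⟨z', (idemCone h').star v' inferInstance⟩ =
      ⟨im f, (idemCone h).star (v ≫ epiPart f) hp⟩ :=
    Cone.ext_comp rfl fun x => by
      show (((idemCone h).comp x ≫ v) ≫ epiPart f) ≫ 𝟙 _ = (idemCone h).comp x ≫ v ≫ epiPart f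
      simp
  have hX : (⟨im f, (idemCone h).star (v ≫ epiPart f) hp⟩ : Cone X.C) ∈ connectionSemigroup X := by
    rw [← e]
    exact mul_mem hγX hδX
  have e' : (⟨_, hγX⟩ * ⟨_, hδX⟩ : connectionSemigroup X) = ⟨_, hX⟩ := Subtype.ext e
  rw [e', connectionFun_eq_star m d h _ hp hX hFp]
  rw [cone_mul_eq (mapStar m d h v hv) (mapStar m d' h' v' hv') (m.F.map (epiPart f))
    (m.F.map (inclPart f)) hF (m.map_incl _ (inclPart_incl f)) (by
      show m.F.map (epiPart f) ≫ m.F.map (inclPart f) =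
        (idemCone (m.map_connected d' h')).comp (m.F.obj z) ≫ m.F.map v'
      rw [← m.F.map_comp, epiPart_inclPart, m.F.map_comp, m.map_cone])]
  refine Cone.ext_comp rfl fun x => ?_
  show ((idemCone (m.map_connected d h)).comp x ≫ m.F.map (v ≫ epiPart f)) ≫ 𝟙 _ =
    ((idemCone (m.map_connected d h)).comp x ≫ m.F.map v) ≫ m.F.map (epiPart f)
  simp

/-- The semigroup homomorphism between connection semigroups induced by a CC-morphism. -/
noncomputable def connectionHom : connectionSemigroup X →ₙ* connectionSemigroup Y where
  toFun γ := ⟨connectionFun m γ, connectionFun_mem m γ⟩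
  map_mul' γ δ := Subtype.ext (connectionFun_mul m γ δ)

theorem connectionHom_id (γ : connectionSemigroup X) : connectionHom (𝟙 X) γ = γ := by
  obtain ⟨c, z, d, h, v, hv, hγ⟩ := exists_cone_eq_star γ
  obtain ⟨γ, hγX⟩ := γ
  subst hγ
  exact Subtype.ext (connectionFun_star (𝟙 X : CCMorphism X X) d h v hv hγX)

theorem connectionHom_comp {Z : ConnectedCategory.{u}} (m : X ⟶ Y) (n : Y ⟶ Z)
    (γ : connectionSemigroup X) :
    connectionHom (m ≫ n) γ = connectionHom n (connectionHom m γ) := by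
  obtain ⟨c, z, d, h, v, hv, hγ⟩ := exists_cone_eq_star γ
  obtain ⟨γ, hγX⟩ := γ
  subst hγ
  refine Subtype.ext ?_
  have h1 : connectionHom m ⟨_, hγX⟩ = ⟨mapStar m d h v hv, by
      rw [← connectionFun_star m d h v hv hγX]; exact connectionFun_mem m _⟩ :=
    Subtype.ext (connectionFun_star m d h v hv hγX)
  rw [h1]
  refine (connectionFun_star (m ≫ n : CCMorphism X Z) d h v hv hγX).trans ?_
  exact (connectionFun_star n (m.G d) (m.map_connected d h) (m.F.map v) inferInstance _).symm

/-- The functor `CC ⥤ LRS` which sends a connected category to its connection semigroup, and a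
CC-morphism `(F, G)` to the homomorphism `ε(c, d) ∗ v ↦ ε(F c, G d) ∗ F v`. -/
noncomputable def connectionFunctor : ConnectedCategory.{u} ⥤ LRS.{u} where
  obj := connectionLRS
  map m := ObjectProperty.homMk (Semigrp.ofHom (connectionHom m))
  map_id X := by
    ext γ : 3
    exact connectionHom_id γ
  map_comp m n := by
    ext γ : 3
    exact connectionHom_comp m n γ

end ConnectionMap

/-! ## The category of principal left ideals -/

section LeftCategory

/-- The principal left ideal `S a`. -/
def leftIdeal {S : Type u} [Semigroup S] (a : S) : Set S := Set.range (fun s => s * a)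

/-- The objects `S e`, `e` idempotent, of the category `L(S)` of principal left ideals. -/
@[ext]
structure LObj (S : Type u) [Semigroup S] : Type u where
  /-- The underlying set. -/
  carrier : Set S
  exists_idem : ∃ e : S, IsIdempotentElem e ∧ carrier = leftIdeal e

/-- The morphisms `r(e, v, f) : S e → S f`, `x ↦ x v`, with `e`, `f` idempotent and `v ∈ e S f`. -/
@[ext]
structure LHom {S : Type u} [Semigroup S] (I J : LObj S) : Type u where
  /-- The underlying map. -/
  toFun : I.carrier → J.carrier
  exists_rep : ∃ e v f : S, IsIdempotentElem e ∧ IsIdempotentElem f ∧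
    I.carrier = leftIdeal e ∧ J.carrier = leftIdeal f ∧ (∃ s, v = e * s * f) ∧
      ∀ x : I.carrier, (toFun x : S) = x * v

variable {S : Type u} [Semigroup S]

theorem mem_leftIdeal_iff {e x : S} (he : IsIdempotentElem e) : x ∈ leftIdeal e ↔ x * e = x := by
  constructor
  · rintro ⟨s, rfl⟩
    show s * e * e = s * e
    rw [mul_assoc, he.eq]
  · exact fun h => ⟨x, h⟩

theorem self_mem_leftIdeal {e : S} (he : IsIdempotentElem e) : e ∈ leftIdeal e := ⟨e, he⟩

theorem mul_mem_leftIdeal {a x : S} (s : S) (h : x ∈ leftIdeal a) : s * x ∈ leftIdeal a := by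
  obtain ⟨t, rfl⟩ := h
  exact ⟨s * t, mul_assoc _ _ _⟩

theorem LObj.mul_mem (I : LObj S) {x : S} (s : S) (h : x ∈ I.carrier) : s * x ∈ I.carrier := by
  obtain ⟨e, -, hI⟩ := I.exists_idem
  rw [hI] at h ⊢
  exact mul_mem_leftIdeal s h

/-- A map of the form `x ↦ x a` from `I` to `J` is a morphism of `L(S)`. -/
def LHom.mulRight {I J : LObj S} (a : S) (h : ∀ x ∈ I.carrier, x * a ∈ J.carrier) : LHom I J where
  toFun x := ⟨x.1 * a, h x.1 x.2⟩
  exists_rep := by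
    obtain ⟨e, he, hI⟩ := I.exists_idem
    obtain ⟨f, hf, hJ⟩ := J.exists_idem
    have h1 : e * a * f = e * a := by
      rw [← mem_leftIdeal_iff hf, ← hJ]
      exact h e (by rw [hI]; exact self_mem_leftIdeal he)
    refine ⟨e, e * a, f, he, hf, hI, hJ, ⟨a, h1.symm⟩, fun x => ?_⟩
    have h2 : x.1 * e = x.1 := (mem_leftIdeal_iff he).1 (hI ▸ x.2)
    show x.1 * a = x.1 * (e * a)
    rw [← mul_assoc, h2]

theorem LHom.exists_mulRight {I J : LObj S} (f : LHom I J) :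
    ∃ v : S, ∀ x : I.carrier, (f.toFun x : S) = x * v := by
  obtain ⟨e, v, f, -, -, -, -, -, h⟩ := f.exists_rep
  exact ⟨v, h⟩

/-- The category `L(S)`; its composition is `r(e, v, f) r(f, w, h) = r(e, v w, h)`. -/
instance : SmallCategory (LObj S) where
  Hom := LHom
  id I := ⟨id, by
    obtain ⟨e, he, hI⟩ := I.exists_idem
    exact ⟨e, e, e, he, he, hI, hI, ⟨e, by rw [he.eq, he.eq]⟩, fun x =>
      ((mem_leftIdeal_iff he).1 (hI ▸ x.2)).symm⟩⟩
  comp {I J K} f g := ⟨g.toFun ∘ f.toFun, by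
    obtain ⟨v, hv⟩ := f.exists_mulRight
    obtain ⟨w, hw⟩ := g.exists_mulRight
    have e : ∀ x : I.carrier, (g.toFun (f.toFun x) : S) = x.1 * (v * w) := fun x => by
      rw [hw, hv, mul_assoc]
    obtain ⟨e', v', f', h1, h2, h3, h4, h5, h6⟩ :=
      (LHom.mulRight (I := I) (J := K) (v * w) fun x hx => by
        rw [← e ⟨x, hx⟩]; exact (g.toFun _).2).exists_rep
    exact ⟨e', v', f', h1, h2, h3, h4, h5, fun x => (e x).trans (h6 x)⟩⟩

/-- The underlying element of the value of a morphism of `L(S)`. -/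
def ev {I J : LObj S} (f : I ⟶ J) (x : I.carrier) : S := (LHom.toFun f x : S)

theorem ev_mem {I J : LObj S} (f : I ⟶ J) (x : I.carrier) : ev f x ∈ J.carrier :=
  (LHom.toFun f x).2

theorem ev_ext {I J : LObj S} {f g : I ⟶ J} (h : ∀ x, ev f x = ev g x) : f = g :=
  LHom.ext (funext fun x => Subtype.ext (h x))

@[simp] theorem ev_id (I : LObj S) (x : I.carrier) : ev (𝟙 I) x = x := rfl

@[simp] theorem ev_comp {I J K : LObj S} (f : I ⟶ J) (g : J ⟶ K) (x : I.carrier) :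
    ev (f ≫ g) x = ev g ⟨ev f x, ev_mem f x⟩ := rfl

@[simp] theorem ev_eqToHom {I J : LObj S} (h : I = J) (x : I.carrier) : ev (eqToHom h) x = x := by
  subst h
  rfl

theorem ev_congr {I J : LObj S} (f : I ⟶ J) {x y : S} (hx : x ∈ I.carrier) (hy : y ∈ I.carrier)
    (h : x = y) : ev f ⟨x, hx⟩ = ev f ⟨y, hy⟩ := by
  subst h
  rfl

/-- The morphism `x ↦ x a`. -/
def mulR {I J : LObj S} (a : S) (h : ∀ x ∈ I.carrier, x * a ∈ J.carrier) : I ⟶ J :=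
  LHom.mulRight a h

@[simp] theorem ev_mulR {I J : LObj S} (a : S) (h : ∀ x ∈ I.carrier, x * a ∈ J.carrier)
    (x : I.carrier) : ev (mulR (J := J) a h) x = x * a := rfl

theorem exists_ev {I J : LObj S} (f : I ⟶ J) : ∃ v : S, ∀ x : I.carrier, ev f x = x * v :=
  LHom.exists_mulRight f

/-- The inclusions of `L(S)` are the set inclusions `r(e, e, f)`, `S e ⊆ S f`. -/
instance : CategoryWithSubobjects (LObj S) where
  Incl {_ _} f := ∀ x, ev f x = x
  incl_id _ _ := rfl
  incl_comp f g hf hg x := (hg ⟨ev f x, ev_mem f x⟩).trans (hf x)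
  incl_unique f g hf hg := ev_ext fun x => (hf x).trans (hg x).symm
  incl_strict f g hf hg _ _ := LObj.ext (Set.Subset.antisymm
    (fun x hx => by
      have := ev_mem f ⟨x, hx⟩
      rwa [hf] at this)
    (fun x hx => by
      have := ev_mem g ⟨x, hx⟩
      rwa [hg] at this))
  incl_mono f hf := ⟨fun g h hgh => ev_ext fun x => by
    have := congrArg (fun k => ev k x) hgh
    simpa [hf _] using this⟩
  incl_of_comp h g hhg hg x := (hg ⟨ev h x, ev_mem h x⟩).symm.trans (hhg x)

theorem incl_iff {I J : LObj S} {f : I ⟶ J} : Incl f ↔ ∀ x, ev f x = x := Iff.rfl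

/-- The inclusion of one principal left ideal in another one. -/
def inclL {I J : LObj S} (h : I.carrier ⊆ J.carrier) : I ⟶ J :=
  ⟨fun x => ⟨x.1, h x.2⟩, by
    obtain ⟨e, he, hI⟩ := I.exists_idem
    have h1 : ∀ x ∈ I.carrier, x * e = x := fun x hx => (mem_leftIdeal_iff he).1 (hI ▸ hx)
    obtain ⟨e', v', f', h2, h3, h4, h5, h6, h7⟩ :=
      (LHom.mulRight (I := I) (J := J) e fun x hx => by rw [h1 x hx]; exact h hx).exists_rep
    exact ⟨e', v', f', h2, h3, h4, h5, h6, fun x => (h1 x x.2).symm.trans (h7 x)⟩⟩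

theorem inclL_incl {I J : LObj S} (h : I.carrier ⊆ J.carrier) : Incl (inclL h) := fun _ => rfl

@[simp] theorem ev_inclL {I J : LObj S} (h : I.carrier ⊆ J.carrier) (x : I.carrier) :
    ev (inclL h) x = x := rfl

variable [IsRegularSemigroup S]

/-- The principal left ideal `S a` as an object of `L(S)`, for any `a`; in a regular semigroup
`S a = S f` for an idempotent `f`. -/
def lobj (a : S) : LObj S where
  carrier := leftIdeal a
  exists_idem := by
    obtain ⟨x, hx⟩ := IsRegularSemigroup.regular a
    refine ⟨x * a, ?_, Set.ext fun y => ⟨?_, ?_⟩⟩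
    · show x * a * (x * a) = x * a
      rw [show x * a * (x * a) = x * (a * x * a) by simp only [mul_assoc], hx]
    · rintro ⟨s, rfl⟩
      refine ⟨s * a, ?_⟩
      show s * a * (x * a) = s * a
      rw [show s * a * (x * a) = s * (a * x * a) by simp only [mul_assoc], hx]
    · rintro ⟨s, rfl⟩
      exact ⟨s * x, mul_assoc _ _ _⟩

theorem self_mem_lobj (a : S) : a ∈ (lobj a).carrier := by
  obtain ⟨x, hx⟩ := IsRegularSemigroup.regular a
  exact ⟨a * x, hx⟩

theorem mul_mem_lobj (x a : S) : x * a ∈ (lobj a).carrier := ⟨x, rfl⟩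

theorem LObj.exists_eq_lobj (I : LObj S) : ∃ e : S, IsIdempotentElem e ∧ I = lobj e := by
  obtain ⟨e, he, hI⟩ := I.exists_idem
  exact ⟨e, he, LObj.ext hI⟩

theorem mulR_isIso {a b : S} (h1 : a * b * a = a) :
    IsIso (mulR (I := lobj (a * b)) (J := lobj a) a fun x _ => mul_mem_lobj x _) := by
  have e1 : IsIdempotentElem (a * b) := by
    show a * b * (a * b) = a * b
    rw [← mul_assoc, h1]
  refine ⟨mulR b fun x hx => ?_, ?_, ?_⟩
  · obtain ⟨s, rfl⟩ := hx
    exact ⟨s, (mul_assoc _ _ _).symm⟩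
  · refine ev_ext fun x => ?_
    show x.1 * a * b = x.1
    rw [mul_assoc]
    exact (mem_leftIdeal_iff e1).1 x.2
  · refine ev_ext ?_
    rintro ⟨x, s, rfl⟩
    show s * a * b * a = s * a
    rw [show s * a * b * a = s * (a * b * a) by simp only [mul_assoc], h1]

/-- The principal cone `r^a`, with vertex `S a` and components `x ↦ x a`. -/
def principalConeTo (a : S) : ConeTo (lobj a) where
  comp _ := mulR a fun x _ => mul_mem_lobj x _
  incl_comp j hj := ev_ext fun x => by
    show ev j x * a = x.1 * a
    rw [incl_iff.1 hj]
  exists_iso := by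
    obtain ⟨b, h1⟩ := IsRegularSemigroup.regular a
    exact ⟨lobj (a * b), mulR_isIso h1⟩

/-- The category `L(S)` of a regular semigroup is normal. -/
instance : NormalCategory (LObj S) where
  split {I J} j hj := by
    obtain ⟨e, he, rfl⟩ := I.exists_eq_lobj
    refine ⟨mulR e fun x _ => mul_mem_lobj x _, ev_ext fun x => ?_⟩
    show ev j x * e = x.1
    rw [incl_iff.1 hj]
    exact (mem_leftIdeal_iff he).1 x.2
  normal_fact {I J} f := by
    obtain ⟨e, he, rfl⟩ := I.exists_eq_lobj
    have hee : e ∈ (lobj e).carrier := self_mem_lobj e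
    obtain ⟨w, hw⟩ := exists_ev f
    obtain ⟨v, hv⟩ : ∃ v, v = ev f ⟨e, hee⟩ := ⟨_, rfl⟩
    have hvw : v = e * w := hv.trans (hw _)
    have hxv : ∀ x : (lobj e).carrier, ev f x = x.1 * v := fun x => by
      rw [hw, hvw, ← mul_assoc, (mem_leftIdeal_iff he).1 x.2]
    have hvJ : v ∈ J.carrier := by rw [hv]; exact ev_mem _ _
    have hev : e * v = v := by rw [hvw, ← mul_assoc, he.eq]
    obtain ⟨b', h1'⟩ := IsRegularSemigroup.regular v
    obtain ⟨b, hb⟩ : ∃ b, b = b' * e := ⟨_, rfl⟩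
    have hbv : b * v = b' * v := by rw [hb, mul_assoc, hev]
    have h1 : v * b * v = v := by rw [mul_assoc, hbv, ← mul_assoc, h1']
    have hbe : b * e = b := by rw [hb, mul_assoc, he.eq]
    have hg : IsIdempotentElem (v * b) := by
      show v * b * (v * b) = v * b
      rw [← mul_assoc, h1]
    refine ⟨lobj (v * b), lobj v, mulR (v * b) fun x _ => mul_mem_lobj x _, _, inclL ?_,
      ⟨inclL ?_, inclL_incl _, ?_⟩, mulR_isIso h1, inclL_incl _, ?_⟩
    · rintro x ⟨s, rfl⟩
      exact J.mul_mem s hvJ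
    · rintro x ⟨s, rfl⟩
      refine ⟨s * (v * b), ?_⟩
      show s * (v * b) * e = s * (v * b)
      rw [mul_assoc, mul_assoc, hbe]
    · refine ev_ext fun x => ?_
      show x.1 * (v * b) = x.1
      exact (mem_leftIdeal_iff hg).1 x.2
    · refine ev_ext fun x => ?_
      show ev f x = x.1 * (v * b) * v
      rw [hxv, mul_assoc, h1]
  exists_cone I := by
    obtain ⟨e, he, rfl⟩ := I.exists_eq_lobj
    exact ⟨principalConeTo e, ev_ext fun x => (mem_leftIdeal_iff he).1 x.2⟩

/-- The principal cone `r^a`. -/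
def principalCone (a : S) : Cone (LObj S) := ⟨lobj a, principalConeTo a⟩

theorem ev_of_eq_principalCone {γ : Cone (LObj S)} {a : S} (h : γ = principalCone a) (I : LObj S)
    (x : I.carrier) : ev (γ.comp I) x = x.1 * a := by
  subst h
  rfl

theorem principalCone_congr {a b : S} (h : ∀ x : S, x * a = x * b) :
    principalCone a = principalCone b := by
  have h1 : lobj a = lobj b := LObj.ext (by
    show leftIdeal a = leftIdeal b
    unfold leftIdeal
    rw [show (fun s => s * a) = fun s => s * b from funext h])
  refine Cone.ext_comp h1 fun I => ev_ext fun x => ?_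
  rw [ev_comp, ev_eqToHom]
  exact h x

theorem principalCone_inj (hS : IsLeftReductive S) {a b : S}
    (h : principalCone a = principalCone b) : a = b := by
  refine hS (funext fun x => ?_)
  exact (ev_of_eq_principalCone h (lobj x) ⟨x, self_mem_lobj x⟩).symm.trans rfl |>.symm

/-- If `γ = r^a ∗ p` then `γ` is principal. -/
theorem exists_principalCone_of_rLe {γ : Cone (LObj S)} {a : S} (h : RLe γ (principalCone a)) :
    ∃ b : S, RLe b a ∧ γ = principalCone b := by
  obtain ⟨p, hp, hγ⟩ := (cone_rLe_iff _ _).1 h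
  obtain ⟨z, γ⟩ := γ
  change lobj a ⟶ z at p
  obtain ⟨w, hw⟩ := exists_ev p
  have hγ' : ∀ (I : LObj S) (x : I.carrier), ev (γ.comp I) x = x.1 * (a * w) := fun I x => by
    have h3 : ev (γ.comp I) x = ev p ⟨x.1 * a, mul_mem_lobj _ _⟩ :=
      congrArg (fun k => ev k x) (hγ I)
    rw [h3, hw, ← mul_assoc]
  have hz : lobj (a * w) = z := by
    refine LObj.ext (Set.Subset.antisymm ?_ ?_)
    · rintro x ⟨s, rfl⟩
      have h1 := ev_mem p ⟨s * a, ⟨s, rfl⟩⟩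
      rw [hw] at h1
      show s * (a * w) ∈ z.carrier
      rw [← mul_assoc]
      exact h1
    · obtain ⟨I, hI⟩ := γ.exists_iso
      intro x hx
      have h1 : inv (γ.comp I) ≫ γ.comp I = 𝟙 z := IsIso.inv_hom_id _
      have h2 : x = ev (γ.comp I) ⟨_, ev_mem (inv (γ.comp I)) ⟨x, hx⟩⟩ := by
        have := congrArg (fun k => ev k ⟨x, hx⟩) h1
        exact this.symm
      rw [h2, hγ' I]
      exact mul_mem_lobj _ _
  refine ⟨a * w, ⟨w, rfl⟩, (Cone.ext_comp hz fun I => ev_ext fun x => ?_).symm⟩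
  rw [ev_comp, ev_eqToHom]
  exact (hγ' I x).symm

/-- `a ↦ r^a` is a homomorphism. -/
theorem principalCone_mul (a b : S) :
    principalCone a * principalCone b = principalCone (a * b) := by
  have hp : ∀ x ∈ (lobj a).carrier, x * b ∈ (lobj (a * b)).carrier := by
    rintro x ⟨s, rfl⟩
    exact ⟨s, (mul_assoc _ _ _).symm⟩
  have hj : (lobj (a * b)).carrier ⊆ (lobj b).carrier := by
    rintro x ⟨s, rfl⟩
    exact ⟨s * a, mul_assoc _ _ _⟩
  have he : Epi (mulR (J := lobj (a * b)) b hp) := ⟨fun g h hgh => ev_ext fun x => by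
    obtain ⟨x, s, rfl⟩ := x
    have h1 := congrArg (fun k => ev k ⟨s * a, mul_mem_lobj s a⟩) hgh
    change ev g ⟨s * a * b, hp _ (mul_mem_lobj s a)⟩ =
      ev h ⟨s * a * b, hp _ (mul_mem_lobj s a)⟩ at h1
    rw [ev_congr g _ (mul_mem_leftIdeal s (self_mem_lobj (a * b))) (mul_assoc s a b),
      ev_congr h _ (mul_mem_leftIdeal s (self_mem_lobj (a * b))) (mul_assoc s a b)] at h1
    exact h1⟩
  rw [cone_mul_eq (principalCone a) (principalCone b) (mulR b hp) (inclL hj) he (inclL_incl _)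
    (ev_ext fun x => rfl)]
  refine Cone.ext_comp rfl fun I => ev_ext fun x => ?_
  rw [ev_comp, ev_eqToHom]
  exact mul_assoc _ _ _

theorem principalCone_idem {e : S} (he : IsIdempotentElem e) :
    IsIdempotentElem (principalCone e) := by
  show _ * _ = _
  rw [principalCone_mul, he.eq]

theorem principalCone_rLe {a b : S} (h : RLe a b) : RLe (principalCone a) (principalCone b) := by
  obtain ⟨s, rfl⟩ := h
  exact ⟨principalCone s, (principalCone_mul _ _).symm⟩

theorem rLe_of_principalCone (hS : IsLeftReductive S) {a b : S}
    (h : RLe (principalCone a) (principalCone b)) : RLe a b := by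
  obtain ⟨c, hc, e⟩ := exists_principalCone_of_rLe h
  rw [principalCone_inj hS e]
  exact hc

variable (S) in
/-- The down-set of the `R`-classes of the principal cones `r^e`, `e` idempotent. -/
def principalClasses : LowerSet (RClass (Cone (LObj S))) where
  carrier := {d | ∃ e : S, IsIdempotentElem e ∧ d = rClass (principalCone e)}
  lower' := by
    rintro d d' hd ⟨e, he, rfl⟩
    obtain ⟨γ, rfl⟩ := Quotient.exists_rep d'
    obtain ⟨b, -, rfl⟩ := exists_principalCone_of_rLe (rClass_le.1 hd)
    obtain ⟨f, hf, hfb⟩ := exists_idem_rClass b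
    exact ⟨f, hf, (rClass_eq.2 ⟨principalCone_rLe (rClass_eq.1 hfb).1,
      principalCone_rLe (rClass_eq.1 hfb).2⟩).symm⟩

variable (S) in
/-- The connected category given by `L(S)` and the `R`-classes of the principal cones. -/
def leftConnected : ConnectedCategory.{u} where
  C := LObj S
  D := principalClasses S
  connects I := by
    obtain ⟨e, he, rfl⟩ := I.exists_eq_lobj
    exact ⟨_, ⟨e, he, rfl⟩, principalConeTo e, principalCone_idem he, rfl⟩

end LeftCategory

section LeftMap

variable {S T : Type u} [Semigroup S] [Semigroup T]

/-- The image of an object `S e` of `L(S)` under a homomorphism `φ`; it is `T (φ e)`, see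
`mapLObj_lobj`. -/
def mapLObj (φ : S →ₙ* T) (I : LObj S) : LObj T where
  carrier := {y | ∃ t : T, ∃ x ∈ I.carrier, y = t * φ x}
  exists_idem := by
    obtain ⟨e, he, hI⟩ := I.exists_idem
    refine ⟨φ e, he.map φ, Set.ext fun y => ⟨?_, ?_⟩⟩
    · rintro ⟨t, x, hx, rfl⟩
      rw [hI] at hx
      obtain ⟨s, rfl⟩ := hx
      exact ⟨t * φ s, by simp [mul_assoc]⟩
    · rintro ⟨t, rfl⟩
      exact ⟨t, e, by rw [hI]; exact self_mem_leftIdeal he, rfl⟩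

/-- The functor `L(S) ⥤ L(T)` induced by a homomorphism `φ`: it sends `S e` to `T (φ e)` and
`r(e, v, f)` to `r(φ e, φ v, φ f)`. -/
noncomputable def mapL (φ : S →ₙ* T) : LObj S ⥤ LObj T where
  obj := mapLObj φ
  map {I J} f := mulR (φ (exists_ev f).choose) (by
    rintro y ⟨t, x, hx, rfl⟩
    refine ⟨t, ev f ⟨x, hx⟩, ev_mem _ _, ?_⟩
    rw [(exists_ev f).choose_spec, map_mul, mul_assoc])
  map_id I := by
    refine ev_ext ?_
    rintro ⟨y, t, x, hx, rfl⟩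
    rw [ev_mulR, ev_id, mul_assoc, ← map_mul, ← (exists_ev (𝟙 I)).choose_spec ⟨x, hx⟩]
    rfl
  map_comp {I J K} f g := by
    refine ev_ext ?_
    rintro ⟨y, t, x, hx, rfl⟩
    have h1 := (exists_ev (f ≫ g)).choose_spec ⟨x, hx⟩
    have h2 := (exists_ev f).choose_spec ⟨x, hx⟩
    have h3 : ev (f ≫ g) ⟨x, hx⟩ = _ := (exists_ev g).choose_spec ⟨_, ev_mem f ⟨x, hx⟩⟩
    show t * φ x * φ (exists_ev (f ≫ g)).choose =
      t * φ x * φ (exists_ev f).choose * φ (exists_ev g).choose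
    rw [mul_assoc, mul_assoc, mul_assoc, ← map_mul, ← map_mul, ← map_mul]
    refine congrArg (fun k => t * φ k) (h1.symm.trans (h3.trans ?_))
    rw [← mul_assoc]
    exact congrArg (fun k => k * _) h2

theorem ev_mapL (φ : S →ₙ* T) {I J : LObj S} (f : I ⟶ J) (t : T) (x : I.carrier)
    (h : t * φ x ∈ ((mapL φ).obj I).carrier) :
    ev ((mapL φ).map f) ⟨t * φ x, h⟩ = t * φ (ev f x) := by
  show t * φ x * φ (exists_ev f).choose = _
  rw [(exists_ev f).choose_spec, map_mul, mul_assoc]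

/-- `r(e, v, f)` is sent to `r(φ e, φ v, φ f)`. -/
theorem ev_mapL_of_ev (φ : S →ₙ* T) {I J : LObj S} (f : I ⟶ J) (v : S)
    (hv : ∀ x : I.carrier, ev f x = x * v) (y : ((mapL φ).obj I).carrier) :
    ev ((mapL φ).map f) y = y * φ v := by
  obtain ⟨y, t, x, hx, rfl⟩ := y
  refine (ev_mapL φ f t ⟨x, hx⟩ _).trans ?_
  rw [hv, map_mul, mul_assoc]

variable [IsRegularSemigroup S] [IsRegularSemigroup T]

theorem mapLObj_lobj (φ : S →ₙ* T) (a : S) : mapLObj φ (lobj a) = lobj (φ a) := by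
  refine LObj.ext (Set.ext fun y => ⟨?_, ?_⟩)
  · rintro ⟨t, x, ⟨s, rfl⟩, rfl⟩
    exact ⟨t * φ s, by simp [mul_assoc]⟩
  · rintro ⟨t, rfl⟩
    exact ⟨t, a, self_mem_lobj a, rfl⟩

theorem mapClass_aux (φ : S →ₙ* T) (d : {d // d ∈ principalClasses S}) :
    rClass (principalCone (φ d.2.choose)) ∈ principalClasses T :=
  ⟨_, d.2.choose_spec.1.map φ, rfl⟩

/-- For left reductive `S`, the map `r_e ↦ r_{φ e}` on the `R`-classes of principal cones; see
`mapClass_mk` for its independence of the choice of `e`. -/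
noncomputable def mapClass (hS : IsLeftReductive S) (φ : S →ₙ* T) :
    {d // d ∈ principalClasses S} →o {d // d ∈ principalClasses T} where
  toFun d := ⟨rClass (principalCone (φ d.2.choose)), mapClass_aux φ d⟩
  monotone' := by
    intro d d' h
    change d.1 ≤ d'.1 at h
    rw [d.2.choose_spec.2, d'.2.choose_spec.2] at h
    obtain ⟨s, hs⟩ := rLe_of_principalCone hS (rClass_le.1 h)
    refine rClass_le.2 (principalCone_rLe ⟨φ s, ?_⟩)
    rw [← map_mul, ← hs]

theorem mapClass_mk (hS : IsLeftReductive S) (φ : S →ₙ* T) (d : {d // d ∈ principalClasses S})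
    {a : S} (h : d.1 = rClass (principalCone a)) :
    (mapClass hS φ d).1 = rClass (principalCone (φ a)) := by
  have h1 := d.2.choose_spec.2.symm.trans h
  have key : ∀ {b c : S}, RLe (principalCone b) (principalCone c) →
      RLe (principalCone (φ b)) (principalCone (φ c)) := fun {b c} hbc => by
    obtain ⟨s, rfl⟩ := rLe_of_principalCone hS hbc
    exact principalCone_rLe ⟨φ s, map_mul _ _ _⟩
  exact rClass_eq.2 ⟨key (rClass_eq.1 h1).1, key (rClass_eq.1 h1).2⟩

/-- An idempotent cone in one of the classes `r_e` is a principal cone `r^f`, `f` idempotent. -/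
theorem exists_eq_principalCone (hS : IsLeftReductive S) {I : LObj S}
    (d : {d // d ∈ principalClasses S}) {ε : ConeTo I} (h : IsConnector d.1 ε) :
    ∃ f : S, IsIdempotentElem f ∧ (⟨I, ε⟩ : Cone (LObj S)) = principalCone f := by
  obtain ⟨e, he, hd⟩ := d.2
  obtain ⟨f, -, hf⟩ := exists_principalCone_of_rLe (rClass_eq.1 (h.2.trans hd)).1
  refine ⟨f, principalCone_inj hS ?_, hf⟩
  rw [← principalCone_mul, ← hf]
  exact h.1

/-- The CC-morphism induced by a homomorphism of left reductive regular semigroups. -/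
noncomputable def leftMorphism (hS : IsLeftReductive S) (φ : S →ₙ* T) :
    leftConnected S ⟶ leftConnected T :=
  have hconn : ∀ (f : S) (_ : IsIdempotentElem f) (d : {d // d ∈ principalClasses S})
      (_ : d.1 = rClass (principalCone f)),
      ∃ ε' : ConeTo (mapLObj φ (lobj f)), IsConnector (mapClass hS φ d).1 ε' ∧
        (⟨_, ε'⟩ : Cone (LObj T)) = principalCone (φ f) := by
    intro f hf d hd
    rw [mapLObj_lobj, mapClass_mk hS φ d hd]
    exact ⟨principalConeTo (φ f), ⟨principalCone_idem (hf.map φ), rfl⟩, rfl⟩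
  have hcone : ∀ {I : LObj S} (d : {d // d ∈ principalClasses S}) {ε : ConeTo I}
      (_ : IsConnector d.1 ε), ∃ ε' : ConeTo (mapLObj φ I), IsConnector (mapClass hS φ d).1 ε' ∧
        ∀ J : LObj S, (mapL φ).map (ε.comp J) = ε'.comp (mapLObj φ J) := by
    intro I d ε h
    obtain ⟨f, hf, hε⟩ := exists_eq_principalCone hS d h
    have hI : I = lobj f := congrArg Cone.vertex hε
    subst hI
    obtain ⟨ε', h1, h2⟩ := hconn f hf d (by rw [← hε]; exact h.2.symm)
    refine ⟨ε', h1, fun J => ev_ext fun y => ?_⟩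
    rw [ev_mapL_of_ev φ _ f (fun x => ev_of_eq_principalCone hε J x)]
    exact (ev_of_eq_principalCone h2 (mapLObj φ J) y).symm
  { F := mapL φ
    G := mapClass hS φ
    map_incl := by
      intro I J j hj
      refine incl_iff.2 ?_
      rintro ⟨y, t, x, hx, rfl⟩
      refine (ev_mapL φ j t ⟨x, hx⟩ _).trans ?_
      rw [incl_iff.1 hj]
    map_connected := by
      rintro I d ⟨ε, h⟩
      obtain ⟨ε', h1, -⟩ := hcone d h
      exact ⟨ε', h1⟩
    map_cone := by
      intro I d h J
      obtain ⟨ε', h1, h2⟩ := hcone d (idemCone_spec h)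
      exact (h2 J).trans (congrArg (fun δ => ConeTo.comp δ (mapLObj φ J))
        (h1.unique (idemCone_spec ⟨ε', h1⟩))) }

theorem mapLObj_id (I : LObj S) : mapLObj (MulHom.id S) I = I := by
  obtain ⟨e, -, rfl⟩ := I.exists_eq_lobj
  exact mapLObj_lobj _ _

theorem mapLObj_comp {U : Type u} [Semigroup U] [IsRegularSemigroup U] (φ : S →ₙ* T)
    (ψ : T →ₙ* U) (I : LObj S) : mapLObj (ψ.comp φ) I = mapLObj ψ (mapLObj φ I) := by
  obtain ⟨e, -, rfl⟩ := I.exists_eq_lobj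
  rw [mapLObj_lobj, mapLObj_lobj, mapLObj_lobj]
  rfl

theorem mapL_id : mapL (MulHom.id S) = 𝟭 (LObj S) := by
  refine CategoryTheory.Functor.ext mapLObj_id ?_
  intro I J f
  refine ev_ext fun y => ?_
  obtain ⟨v, hv⟩ := exists_ev f
  rw [ev_comp, ev_comp, ev_eqToHom]
  refine (ev_mapL_of_ev _ f v hv y).trans (Eq.trans ?_ (hv _).symm)
  exact congrArg (fun k => k * _) (ev_eqToHom _ _).symm

theorem mapL_comp {U : Type u} [Semigroup U] [IsRegularSemigroup U] (φ : S →ₙ* T)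
    (ψ : T →ₙ* U) : mapL (ψ.comp φ) = mapL φ ⋙ mapL ψ := by
  refine CategoryTheory.Functor.ext (mapLObj_comp φ ψ) ?_
  intro I J f
  refine ev_ext fun y => ?_
  obtain ⟨v, hv⟩ := exists_ev f
  rw [ev_comp, ev_comp, ev_eqToHom]
  refine (ev_mapL_of_ev _ f v hv y).trans
    (Eq.trans ?_ (ev_mapL_of_ev ψ _ (φ v) (ev_mapL_of_ev φ f v hv) _).symm)
  exact congrArg (fun k => k * _) (ev_eqToHom _ _).symm

theorem leftMorphism_id (hS : IsLeftReductive S) :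
    leftMorphism hS (MulHom.id S) = 𝟙 (leftConnected S) := by
  refine CCMorphism.ext mapL_id (OrderHom.ext _ _ (funext fun d => Subtype.ext ?_))
  exact (mapClass_mk hS _ d d.2.choose_spec.2).trans d.2.choose_spec.2.symm

theorem leftMorphism_comp {U : Type u} [Semigroup U] [IsRegularSemigroup U]
    (hS : IsLeftReductive S) (hT : IsLeftReductive T) (φ : S →ₙ* T) (ψ : T →ₙ* U) :
    leftMorphism hS (ψ.comp φ) = leftMorphism hS φ ≫ leftMorphism hT ψ := by
  refine CCMorphism.ext (mapL_comp φ ψ) (OrderHom.ext _ _ (funext fun d => Subtype.ext ?_))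
  refine (mapClass_mk hS _ d d.2.choose_spec.2).trans ?_
  exact (mapClass_mk hT ψ (mapClass hS φ d) (mapClass_mk hS φ d d.2.choose_spec.2)).symm

instance (S : LRS.{u}) : IsRegularSemigroup S.obj := S.property.1

/-- The functor `LRS ⥤ CC` which sends `S` to `L(S)` connected by the `R`-classes of principal
cones, and a homomorphism `φ` to the CC-morphism `(F_φ, G_φ)`. -/
noncomputable def leftFunctor : LRS.{u} ⥤ ConnectedCategory.{u} where
  obj S := leftConnected S.obj
  map {S _} φ := leftMorphism S.property.2 φ.hom.hom
  map_id S := leftMorphism_id S.property.2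
  map_comp {S T _} φ ψ := leftMorphism_comp S.property.2 T.property.2 φ.hom.hom ψ.hom.hom

end LeftMap

end CrossConn

/-!
The two natural isomorphisms are written down explicitly.

For a left reductive regular semigroup `S`, the map `a ↦ r^a` is an isomorphism from `S` to the
connection semigroup of `L(S)`: it is injective because `S` is left reductive, and surjective
because a cone below a principal cone in the `R`-order is principal (`principalEquiv`). It is
natural because `r^a = r^e ∗ (x ↦ x a)` for an idempotent `e` in the `R`-class of `a`, and the
semigroup map induced by `(F_φ, G_φ)` turns this into `r^{φ e} ∗ (y ↦ y φ(a)) = r^{φ a}`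
(`connectionFun_principalCone`).

For a connected category `X` with connection semigroup `Ŝ`, each principal left ideal of `Ŝ` is the
set of the cones in `Ŝ` whose vertex is included in some object `c`, and `c` is determined by the
ideal. Say that a cone `δ` represents `f : c ⟶ c'` if `δ(c)` followed by an inclusion is `f`. Right
multiplication by `δ` on the ideal of `c` then depends only on `f` (`Represents.mul_eq`), each `f`
is represented by a cone in `Ŝ`, and each morphism between the ideals comes from exactly one `f`:
the value at an idempotent `ε` with vertex `c` of right multiplication by `v` is a cone `ε v` that
represents `f`. This gives a fully faithful functor which is bijective on objects and preserves
and reflects inclusions (`idealFunctor`). With the map `R_γ ↦ R_{r^γ}` on the down-sets, an order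
isomorphism as `Ŝ` is left reductive, it forms a CC-morphism `counitInv X`, which is invertible by
`isIso_of_bijective`. Naturality holds because the map induced by a CC-morphism `(F, G)` sends
`ε(c, d)` to `ε(F c, G d)` and cones that represent `f` to cones that represent `F f`.
-/

namespace CrossConn

open CategoryWithSubobjects

/-! ### Invertible morphisms of connected categories -/

section InverseMorphism

/-- The inverse of a fully faithful functor `F` along a section `g` of its object map, which
inverts `F` strictly when `F` is injective on objects. -/
noncomputable def inverseFunctor {C D : Type u} [SmallCategory C] [SmallCategory D] (F : C ⥤ D)
    [F.Full] [F.Faithful] (g : D → C) (hg : ∀ d, F.obj (g d) = d) : D ⥤ C where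
  obj := g
  map {a b} f := F.preimage (eqToHom (hg a) ≫ f ≫ eqToHom (hg b).symm)
  map_id a := F.map_injective (by simp)
  map_comp f f' := F.map_injective (by simp)

theorem map_inverseFunctor_map {C D : Type u} [SmallCategory C] [SmallCategory D] (F : C ⥤ D)
    [F.Full] [F.Faithful] (g : D → C) (hg : ∀ d, F.obj (g d) = d) {a b : D} (f : a ⟶ b) :
    F.map ((inverseFunctor F g hg).map f) = eqToHom (hg a) ≫ f ≫ eqToHom (hg b).symm :=
  F.map_preimage _

theorem inverseFunctor_comp {C D : Type u} [SmallCategory C] [SmallCategory D] (F : C ⥤ D)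
    [F.Full] [F.Faithful] (g : D → C) (hg : ∀ d, F.obj (g d) = d) :
    inverseFunctor F g hg ⋙ F = 𝟭 D :=
  CategoryTheory.Functor.ext hg fun _ _ f => map_inverseFunctor_map F g hg f

theorem map_conj_eqToHom {C D : Type u} [SmallCategory C] [SmallCategory D] (F : C ⥤ D)
    {a a' b b' : C} (ha : a' = a) (hb : b' = b) (f : a ⟶ b) :
    F.map (eqToHom ha ≫ f ≫ eqToHom hb.symm) =
      eqToHom (congrArg F.obj ha) ≫ F.map f ≫ eqToHom (congrArg F.obj hb).symm := by
  subst ha hb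
  simp

theorem comp_inverseFunctor {C D : Type u} [SmallCategory C] [SmallCategory D] (F : C ⥤ D)
    [F.Full] [F.Faithful] (g : D → C) (hg : ∀ d, F.obj (g d) = d) (hg' : ∀ c, g (F.obj c) = c) :
    F ⋙ inverseFunctor F g hg = 𝟭 C :=
  CategoryTheory.Functor.ext hg' fun _ _ f => F.map_injective
    ((map_inverseFunctor_map F g hg (F.map f)).trans (map_conj_eqToHom F (hg' _) (hg' _) f).symm)

theorem idemCone_comp_eq {C : Type u} [SmallCategory C] [NormalCategory C] {c c' : C}
    {d d' : RClass (Cone C)} (h : ConnectedBy c d) (h' : ConnectedBy c' d') (hc : c = c')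
    (hd : d = d') {x x' : C} (hx : x = x') :
    (idemCone h).comp x = eqToHom hx ≫ (idemCone h').comp x' ≫ eqToHom hc.symm := by
  subst hc hd hx
  simp

theorem rClass_star_of_isIso {C : Type u} [SmallCategory C] [NormalCategory C] {z w : C}
    (γ : ConeTo z) (v : z ⟶ w) [IsIso v] :
    rClass (⟨w, γ.star v inferInstance⟩ : Cone C) = rClass ⟨z, γ⟩ :=
  rClass_eq.2 ⟨(cone_rLe_iff _ _).2 ⟨v, inferInstance, fun _ => rfl⟩,
    (cone_rLe_iff _ _).2 ⟨inv v, inferInstance, fun c => by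
      show γ.comp c = (γ.comp c ≫ v) ≫ inv v
      simp⟩⟩

variable {X Y : ConnectedCategory.{u}}

/-- A CC-morphism with a fully faithful functor reflects connectedness. If `b` is connected by
`d`, then the idempotent cone at `F c` is `ε(F b, G d) ∗ F v` for some isomorphism `v`, and
`ε(b, d) ∗ v` connects `c` to `d`. -/
theorem connectedBy_of_map (m : CCMorphism X Y) [m.F.Full] [m.F.Faithful] {c : X.C}
    (d : {d // d ∈ X.D}) (h : ConnectedBy (m.F.obj c) (m.G d).1) : ConnectedBy c d.1 := by
  obtain ⟨ε', h'⟩ := h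
  obtain ⟨b, hb⟩ := exists_connectedBy d.1
  have s := idemCone_spec (m.map_connected d hb)
  obtain ⟨hiso, hcomp⟩ := comp_of_isConnector (⟨m.F.obj c, ε'⟩ : Cone Y.C)
    (ε := idemCone (m.map_connected d hb)) (by rw [h'.2]; exact s)
  change IsIso (ε'.comp (m.F.obj b)) at hiso
  obtain ⟨v, hv⟩ := m.F.map_surjective (ε'.comp (m.F.obj b))
  have hv1 : IsIso (m.F.map v) := by rw [hv]; exact hiso
  have hv2 : IsIso v := isIso_of_fully_faithful m.F v
  refine ⟨(idemCone hb).star v inferInstance, (cone_idem_iff _).2 (m.F.map_injective ?_),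
    (rClass_star_of_isIso _ v).trans (idemCone_spec hb).2⟩
  show m.F.map ((idemCone hb).comp c ≫ v) = _
  rw [m.F.map_comp, m.F.map_id, hv, m.map_cone d hb]
  exact (hcomp _).symm.trans ((cone_idem_iff ε').1 h'.1)

/-- The inverse of a CC-morphism which is fully faithful, reflects inclusions, and has sections
on objects and on the down-sets. -/
noncomputable def inverseMorphism (m : CCMorphism X Y) [m.F.Full] [m.F.Faithful] (g : Y.C → X.C)
    (hg : ∀ c, m.F.obj (g c) = c)
    (hincl : ∀ {a b : X.C} (j : a ⟶ b), Incl (m.F.map j) → Incl j)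
    (G' : {d // d ∈ Y.D} →o {d // d ∈ X.D}) (hG : ∀ d, m.G (G' d) = d) : CCMorphism Y X :=
  have hconn : ∀ {c : Y.C} (d : {d // d ∈ Y.D}), ConnectedBy c d.1 →
      ConnectedBy (m.F.obj (g c)) (m.G (G' d)).1 := fun {c} d h => by rw [hg, hG]; exact h
  { F := inverseFunctor m.F g hg
    G := G'
    map_incl := fun j hj => hincl _ (by
      rw [map_inverseFunctor_map]
      exact incl_comp _ _ (incl_eqToHom _) (incl_comp _ _ hj (incl_eqToHom _)))
    map_connected := fun d h => connectedBy_of_map m (G' d) (hconn d h)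
    map_cone := fun d h x => m.F.map_injective (by
      rw [map_inverseFunctor_map]
      refine Eq.trans ?_ (m.map_cone (G' d) (connectedBy_of_map m (G' d) (hconn d h)) _).symm
      exact (idemCone_comp_eq _ h (hg _) (congrArg Subtype.val (hG d)) (hg x)).symm) }

/-- A CC-morphism `(F, G)` is invertible if `F` is fully faithful, bijective on objects and
reflects inclusions, and `G` is surjective and reflects the order. -/
theorem isIso_of_bijective (m : X ⟶ Y) (hfull : (CCMorphism.F m).Full)
    (hfaith : (CCMorphism.F m).Faithful)
    (hobj : Function.Bijective (CCMorphism.F m).obj)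
    (hincl : ∀ {a b : X.C} (j : a ⟶ b), Incl ((CCMorphism.F m).map j) → Incl j)
    (hle : ∀ d d', CCMorphism.G m d ≤ CCMorphism.G m d' → d ≤ d')
    (hsurj : Function.Surjective (CCMorphism.G m)) : IsIso m := by
  choose g hg using hobj.2
  choose k hk using hsurj
  let G' : {d // d ∈ Y.D} →o {d // d ∈ X.D} :=
    ⟨k, fun d d' h => hle _ _ (by rw [hk, hk]; exact h)⟩
  refine ⟨inverseMorphism m g hg hincl G' hk,
    CCMorphism.ext (comp_inverseFunctor _ g hg fun c => hobj.1 (hg _))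
      (OrderHom.ext _ _ (funext fun d => ?_)),
    CCMorphism.ext (inverseFunctor_comp _ g hg) (OrderHom.ext _ _ (funext fun d => hk d))⟩
  exact le_antisymm (hle _ _ (hk _).le) (hle _ _ (hk _).ge)

end InverseMorphism

/-! ### Cones that represent morphisms -/

section Represents

variable {C : Type u} [SmallCategory C] [NormalCategory C]

theorem incl_cone_comp (γ : Cone C) {a b : C} {j : a ⟶ b} (hj : Incl j) :
    j ≫ γ.comp b = γ.comp a :=
  γ.toConeTo.incl_comp j hj

/-- A cone `δ` represents a morphism `f : c ⟶ c'` if `δ(c)` followed by an inclusion is `f`. For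
an idempotent cone `ε` with vertex `c`, the cone `ε ∗ f°` represents `f`. -/
def Represents {c c' : C} (f : c ⟶ c') (δ : Cone C) : Prop :=
  ∃ k : δ.vertex ⟶ c', Incl k ∧ δ.comp c ≫ k = f

theorem Represents.unique {c c' : C} {f g : c ⟶ c'} {δ : Cone C} (hf : Represents f δ)
    (hg : Represents g δ) : f = g := by
  obtain ⟨k, hk, rfl⟩ := hf
  obtain ⟨l, hl, rfl⟩ := hg
  rw [incl_unique k l hk hl]

theorem represents_id {c : C} {ε : ConeTo c} (hε : ε.comp c = 𝟙 c) :
    Represents (𝟙 c) (⟨c, ε⟩ : Cone C) :=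
  ⟨𝟙 c, incl_id c, by rw [Category.comp_id]; exact hε⟩

theorem Represents.comp {c c' c'' : C} {f : c ⟶ c'} {g : c' ⟶ c''} {δ η : Cone C}
    (hf : Represents f δ) (hg : Represents g η) : Represents (f ≫ g) (δ * η) := by
  obtain ⟨k, hk, rfl⟩ := hf
  obtain ⟨l, hl, rfl⟩ := hg
  refine ⟨inclPart (η.comp δ.vertex) ≫ l, incl_comp _ _ (inclPart_incl _) hl, ?_⟩
  show (δ.comp c ≫ epiPart (η.comp δ.vertex)) ≫ inclPart (η.comp δ.vertex) ≫ l = _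
  rw [Category.assoc, ← Category.assoc (epiPart _), epiPart_inclPart, ← incl_cone_comp η hk]
  simp only [Category.assoc]

/-- Right multiplication by a cone which represents `f : c ⟶ c'` depends only on `f` on the cones
whose vertex is included in `c`: for `j : z_γ ⟶ c`, it sends `γ` to `γ ∗ (j f)°`. -/
theorem Represents.mul_eq {c c' : C} {f : c ⟶ c'} {γ δ : Cone C} (h : Represents f δ)
    {j : γ.vertex ⟶ c} (hj : Incl j) {w : C} {p : γ.vertex ⟶ w} (hp : Epi p) {i : w ⟶ c'}
    (hi : Incl i) (e : p ≫ i = j ≫ f) : γ * δ = ⟨w, γ.toConeTo.star p hp⟩ := by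
  obtain ⟨k, hk, rfl⟩ := h
  obtain ⟨e', he'⟩ := canonical_unique (epiPart_epi (δ.comp γ.vertex))
    (incl_comp _ _ (inclPart_incl (δ.comp γ.vertex)) hk) hp hi (by
      rw [← Category.assoc, epiPart_inclPart, e, ← incl_cone_comp δ hj, Category.assoc])
  exact ConeTo.star_congr _ _ _ e' he'

theorem Represents.mul_congr {c c' : C} {f : c ⟶ c'} {γ δ δ' : Cone C} (h : Represents f δ)
    (h' : Represents f δ') {j : γ.vertex ⟶ c} (hj : Incl j) : γ * δ = γ * δ' :=
  (h.mul_eq hj (epiPart_epi (j ≫ f)) (inclPart_incl _) (epiPart_inclPart _)).trans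
    (h'.mul_eq hj (epiPart_epi (j ≫ f)) (inclPart_incl _) (epiPart_inclPart _)).symm

/-- A cone which represents an inclusion acts identically. -/
theorem Represents.mul_eq_self {c c' : C} {f : c ⟶ c'} (hf : Incl f) {γ δ : Cone C}
    (h : Represents f δ) {j : γ.vertex ⟶ c} (hj : Incl j) : γ * δ = γ := by
  rw [h.mul_eq hj (p := 𝟙 _) inferInstance (incl_comp _ _ hj hf) (Category.id_comp _)]
  exact Cone.ext_comp rfl fun c => by
    show (γ.comp c ≫ 𝟙 _) ≫ 𝟙 _ = _
    rw [Category.comp_id, Category.comp_id]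

/-- The vertex of a product is included in the object to which the right factor is mapped. -/
theorem exists_incl_mul (γ δ : Cone C) {c : C} (h : ∃ k : δ.vertex ⟶ c, Incl k) :
    ∃ k : (γ * δ).vertex ⟶ c, Incl k := by
  obtain ⟨k, hk⟩ := h
  exact ⟨inclPart (δ.comp γ.vertex) ≫ k, incl_comp _ _ (inclPart_incl _) hk⟩

theorem exists_represents (X : ConnectedCategory.{u}) {c c' : X.C} (f : c ⟶ c') :
    ∃ v : connectionSemigroup X, Represents f v.1 := by
  obtain ⟨ε, hε, hX⟩ := exists_idem_vertex X c
  refine ⟨⟨_, star_mem_connectionSemigroup X ε (epiPart f) inferInstance hX⟩,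
    inclPart f, inclPart_incl f, ?_⟩
  show (ε.comp c ≫ epiPart f) ≫ inclPart f = f
  rw [hε, Category.id_comp, epiPart_inclPart]

end Represents

/-! ### The left ideals of the connection semigroup -/

section VertexIdeal

variable {X : ConnectedCategory.{u}}

theorem setOf_incl_eq_leftIdeal {c : X.C} {ε : ConeTo c} (hε : ε.comp c = 𝟙 c)
    (hX : (⟨c, ε⟩ : Cone X.C) ∈ connectionSemigroup X) :
    {γ : connectionSemigroup X | ∃ j : γ.1.vertex ⟶ c, Incl j} =
      leftIdeal (⟨⟨c, ε⟩, hX⟩ : connectionSemigroup X) := by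
  refine Set.ext fun γ => ⟨?_, ?_⟩
  · rintro ⟨j, hj⟩
    exact ⟨γ, Subtype.ext ((represents_id hε).mul_eq_self (incl_id c) hj)⟩
  · rintro ⟨s, rfl⟩
    exact exists_incl_mul s.1 ⟨c, ε⟩ ⟨𝟙 c, incl_id c⟩

/-- The left ideal of the connection semigroup that consists of the cones whose vertex is included
in `c`; it is generated by each idempotent with vertex `c`, see `vertexIdeal_eq_lobj`. -/
def vertexIdeal (c : X.C) : LObj (connectionSemigroup X) where
  carrier := {γ | ∃ j : γ.1.vertex ⟶ c, Incl j}
  exists_idem := by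
    obtain ⟨ε, hε, hX⟩ := exists_idem_vertex X c
    exact ⟨⟨_, hX⟩, Subtype.ext ((cone_idem_iff ε).2 hε), setOf_incl_eq_leftIdeal hε hX⟩

theorem vertexIdeal_eq_lobj {c : X.C} {ε : ConeTo c} (hε : ε.comp c = 𝟙 c)
    (hX : (⟨c, ε⟩ : Cone X.C) ∈ connectionSemigroup X) :
    vertexIdeal c = lobj (⟨⟨c, ε⟩, hX⟩ : connectionSemigroup X) :=
  LObj.ext (setOf_incl_eq_leftIdeal hε hX)

theorem mem_vertexIdeal_self {c : X.C} {ε : ConeTo c}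
    (hX : (⟨c, ε⟩ : Cone X.C) ∈ connectionSemigroup X) :
    (⟨⟨c, ε⟩, hX⟩ : connectionSemigroup X) ∈ (vertexIdeal c).carrier :=
  ⟨𝟙 c, incl_id c⟩

theorem vertexIdeal_injective : Function.Injective (vertexIdeal (X := X)) := by
  have key : ∀ {a b : X.C}, vertexIdeal a = vertexIdeal b → ∃ j : a ⟶ b, Incl j := by
    intro a b h
    obtain ⟨ε, -, hX⟩ := exists_idem_vertex X a
    exact (h ▸ mem_vertexIdeal_self hX : _ ∈ (vertexIdeal b).carrier)
  intro a b h
  obtain ⟨j, hj⟩ := key h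
  obtain ⟨k, hk⟩ := key h.symm
  exact incl_antisymm hj hk

theorem vertexIdeal_surjective : Function.Surjective (vertexIdeal (X := X)) := by
  intro I
  obtain ⟨⟨⟨c, ε⟩, hX⟩, he, rfl⟩ := I.exists_eq_lobj
  exact ⟨c, vertexIdeal_eq_lobj ((cone_idem_iff ε).1 (congrArg Subtype.val he)) hX⟩

theorem mul_mem_vertexIdeal {c c' : X.C} {f : c ⟶ c'} {v : connectionSemigroup X}
    (hv : Represents f v.1) (γ : connectionSemigroup X) : γ * v ∈ (vertexIdeal c').carrier := by
  obtain ⟨k, hk, -⟩ := hv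
  exact exists_incl_mul γ.1 v.1 ⟨k, hk⟩

variable (X) in
/-- The functor from `C` to the category of principal left ideals of its connection semigroup.
A morphism `f` is sent to right multiplication by any cone that represents it, see
`ev_idealFunctor_map`. -/
noncomputable def idealFunctor : X.C ⥤ LObj (connectionSemigroup X) where
  obj := vertexIdeal
  map {c c'} f := mulR (exists_represents X f).choose fun γ _ =>
    mul_mem_vertexIdeal (exists_represents X f).choose_spec γ
  map_id c := ev_ext fun ⟨_, _, hj⟩ => Subtype.ext
    ((exists_represents X (𝟙 c)).choose_spec.mul_eq_self (incl_id c) hj)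
  map_comp f g := ev_ext fun ⟨γ, j, hj⟩ => by
    refine Eq.trans ?_ (mul_assoc γ _ _).symm
    exact Subtype.ext ((exists_represents X (f ≫ g)).choose_spec.mul_congr
      ((exists_represents X f).choose_spec.comp (exists_represents X g).choose_spec) hj)

theorem ev_idealFunctor_map {c c' : X.C} {f : c ⟶ c'} {v : connectionSemigroup X}
    (hv : Represents f v.1) (γ : (vertexIdeal c).carrier) :
    ev ((idealFunctor X).map f) γ = γ.1 * v := by
  obtain ⟨γ, j, hj⟩ := γ
  exact Subtype.ext ((exists_represents X f).choose_spec.mul_congr hv hj)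

/-- The value of the ideal functor on `f` at an idempotent with vertex the domain of `f`
represents `f`. -/
theorem represents_ev_idealFunctor_map {c c' : X.C} (f : c ⟶ c') {ε : ConeTo c}
    (hε : ε.comp c = 𝟙 c) (hX : (⟨c, ε⟩ : Cone X.C) ∈ connectionSemigroup X) :
    Represents f (ev ((idealFunctor X).map f) ⟨⟨⟨c, ε⟩, hX⟩, mem_vertexIdeal_self hX⟩).1 := by
  obtain ⟨v, hv⟩ := exists_represents X f
  have h := (represents_id hε).comp hv
  rw [Category.id_comp] at h
  exact (congrArg (fun γ : connectionSemigroup X => Represents f γ.1)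
    (ev_idealFunctor_map hv ⟨_, mem_vertexIdeal_self hX⟩)).mpr h

theorem idealFunctor_faithful : (idealFunctor X).Faithful where
  map_injective {c _} f g h := by
    obtain ⟨ε, hε, hX⟩ := exists_idem_vertex X c
    have hf := represents_ev_idealFunctor_map f hε hX
    rw [h] at hf
    exact hf.unique (represents_ev_idealFunctor_map g hε hX)

theorem idealFunctor_full : (idealFunctor X).Full where
  map_surjective {c c'} h := by
    obtain ⟨ε, hε, hX⟩ := exists_idem_vertex X c
    obtain ⟨v, hv⟩ := exists_ev h
    -- On `S ε = F c`, right multiplication by `v` agrees with right multiplication by `ε v`, and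
    -- the vertex of `ε v` is included in `c'`, so that `ε v` represents a morphism.
    obtain ⟨k, hk⟩ : (⟨_, hX⟩ * v : connectionSemigroup X) ∈ (vertexIdeal c').carrier := by
      rw [← hv ⟨_, mem_vertexIdeal_self hX⟩]
      exact ev_mem h _
    refine ⟨_, ev_ext fun γ => (ev_idealFunctor_map ⟨k, hk, rfl⟩ γ).trans ?_⟩
    obtain ⟨γ, j, hj⟩ := γ
    have e : γ * ⟨_, hX⟩ = γ := Subtype.ext ((represents_id hε).mul_eq_self (incl_id c) hj)
    refine Eq.trans ?_ (hv _).symm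
    rw [← mul_assoc]
    exact congrArg (fun x => x * v) e

theorem incl_of_idealFunctor_map {c c' : X.C} (f : c ⟶ c') (h : Incl ((idealFunctor X).map f)) :
    Incl f := by
  obtain ⟨ε, hε, hX⟩ := exists_idem_vertex X c
  have hf := represents_ev_idealFunctor_map f hε hX
  rw [incl_iff.1 h] at hf
  obtain ⟨k, hk, e⟩ := hf
  change ε.comp c ≫ k = f at e
  rw [hε, Category.id_comp] at e
  exact e ▸ hk

theorem idealFunctor_map_incl {c c' : X.C} (f : c ⟶ c') (h : Incl f) :
    Incl ((idealFunctor X).map f) := fun ⟨_, _, hj⟩ =>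
  Subtype.ext ((exists_represents X f).choose_spec.mul_eq_self h hj)

end VertexIdeal

/-! ### A connected category and its connection semigroup -/

section Counit

variable {X Y : ConnectedCategory.{u}}

/-- The quasi-order of the connection semigroup is that of the semigroup of all cones. -/
theorem rLe_connectionSemigroup {γ δ : connectionSemigroup X} :
    RLe γ δ ↔ RLe γ.1 δ.1 := by
  constructor
  · rintro ⟨s, rfl⟩
    exact ⟨s.1, rfl⟩
  · rintro ⟨η, hη⟩
    obtain ⟨x, hx⟩ := IsRegularSemigroup.regular δ
    refine ⟨x * γ, Subtype.ext ?_⟩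
    have hx' : δ.1 * x.1 * δ.1 = δ.1 := congrArg Subtype.val hx
    show γ.1 = δ.1 * (x.1 * γ.1)
    rw [hη, ← mul_assoc, ← mul_assoc, hx']

theorem principalCone_rLe_iff {γ δ : connectionSemigroup X} :
    RLe (principalCone γ) (principalCone δ) ↔ RLe γ.1 δ.1 :=
  ⟨fun h => rLe_connectionSemigroup.1
      (rLe_of_principalCone (connectionSemigroup_leftReductive X) h),
    fun h => principalCone_rLe (rLe_connectionSemigroup.2 h)⟩

theorem principalClass_eq {γ δ : connectionSemigroup X} (h : rClass γ.1 = rClass δ.1) :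
    rClass (principalCone γ) = rClass (principalCone δ) :=
  rClass_eq.2 ⟨principalCone_rLe_iff.2 (rClass_eq.1 h).1, principalCone_rLe_iff.2 (rClass_eq.1 h).2⟩

theorem rClass_principalCone_mem {S : Type u} [Semigroup S] [IsRegularSemigroup S] (a : S) :
    rClass (principalCone a) ∈ principalClasses S := by
  obtain ⟨e, he, h⟩ := exists_idem_rClass a
  exact ⟨e, he, rClass_eq.2 ⟨principalCone_rLe (rClass_eq.1 h).2,
    principalCone_rLe (rClass_eq.1 h).1⟩⟩

theorem exists_rClass_eq (d : {d // d ∈ X.D}) : ∃ γ : connectionSemigroup X, rClass γ.1 = d.1 := by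
  obtain ⟨d, hd⟩ := d
  obtain ⟨γ, rfl⟩ := Quotient.exists_rep d
  exact ⟨⟨γ, hd⟩, rfl⟩

variable (X) in
/-- The map `R_γ ↦ R_{r^γ}` from the down-set of a connected category to the classes of the
principal cones of its connection semigroup, see `classMap_mk`. -/
noncomputable def classMap : {d // d ∈ X.D} →o {d // d ∈ principalClasses (connectionSemigroup X)}
    where
  toFun d := ⟨rClass (principalCone (exists_rClass_eq d).choose), rClass_principalCone_mem _⟩
  monotone' d d' h := by
    refine rClass_le.2 (principalCone_rLe_iff.2 (rClass_le.1 ?_))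
    rw [(exists_rClass_eq d).choose_spec, (exists_rClass_eq d').choose_spec]
    exact h

theorem classMap_mk {d : {d // d ∈ X.D}} {γ : connectionSemigroup X} (h : rClass γ.1 = d.1) :
    (classMap X d).1 = rClass (principalCone γ) :=
  principalClass_eq ((exists_rClass_eq d).choose_spec.trans h.symm)

theorem le_of_classMap_le {d d' : {d // d ∈ X.D}} (h : classMap X d ≤ classMap X d') :
    d ≤ d' := by
  have h1 := principalCone_rLe_iff.1 (rClass_le.1 h)
  rw [← rClass_le, (exists_rClass_eq d).choose_spec, (exists_rClass_eq d').choose_spec] at h1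
  exact h1

theorem classMap_surjective : Function.Surjective (classMap X) := by
  rintro ⟨d, e, -, rfl⟩
  exact ⟨⟨rClass e.1, e.2⟩, Subtype.ext (classMap_mk rfl)⟩

theorem idemCone_mem {c : X.C} (d : {d // d ∈ X.D}) (h : ConnectedBy c d.1) :
    (⟨c, idemCone h⟩ : Cone X.C) ∈ connectionSemigroup X := by
  show rClass _ ∈ X.D
  rw [(idemCone_spec h).2]
  exact d.2

theorem idemCone_comp_self {C : Type u} [SmallCategory C] [NormalCategory C] {c : C}
    {d : RClass (Cone C)} (h : ConnectedBy c d) : (idemCone h).comp c = 𝟙 c :=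
  (cone_idem_iff _).1 (idemCone_spec h).1

/-- The image of an idempotent cone under the ideal functor is the principal cone it defines. -/
theorem exists_connector_idealFunctor {c : X.C} (d : {d // d ∈ X.D}) (h : ConnectedBy c d.1) :
    ∃ ε' : ConeTo (vertexIdeal c), IsConnector (classMap X d).1 ε' ∧
      ∀ x, (idealFunctor X).map ((idemCone h).comp x) = ε'.comp (vertexIdeal x) := by
  have hX := idemCone_mem d h
  have h1 := idemCone_comp_self h
  obtain ⟨ε', hε'⟩ : ∃ ε' : ConeTo (vertexIdeal c),
      (⟨_, ε'⟩ : Cone _) = principalCone (⟨_, hX⟩ : connectionSemigroup X) := by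
    rw [vertexIdeal_eq_lobj h1 hX]
    exact ⟨_, rfl⟩
  refine ⟨ε', ⟨?_, ?_⟩, fun x => ev_ext fun γ => ?_⟩
  · rw [hε']
    exact principalCone_idem (Subtype.ext (idemCone_spec h).1)
  · rw [hε']
    exact (classMap_mk (γ := ⟨_, hX⟩) (idemCone_spec h).2).symm
  · refine Eq.trans ?_ (ev_of_eq_principalCone hε' (vertexIdeal x) γ).symm
    exact ev_idealFunctor_map (v := ⟨_, hX⟩) ⟨𝟙 c, incl_id c, Category.comp_id _⟩ γ

variable (X) in
/-- The CC-morphism from a connected category to the one given by its connection semigroup. -/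
noncomputable def counitInv : X ⟶ leftConnected (connectionSemigroup X) :=
  { F := idealFunctor X
    G := classMap X
    map_incl := fun j hj => idealFunctor_map_incl j hj
    map_connected := fun d h => by
      obtain ⟨ε', h1, -⟩ := exists_connector_idealFunctor d h
      exact ⟨ε', h1⟩
    map_cone := fun d h x => by
      obtain ⟨ε', h1, h2⟩ := exists_connector_idealFunctor d h
      exact (h2 x).trans (congrArg (fun δ => ConeTo.comp δ (vertexIdeal x))
        (h1.unique (idemCone_spec ⟨ε', h1⟩))) }

instance counitInv_isIso : IsIso (counitInv X) :=
  isIso_of_bijective _ idealFunctor_full idealFunctor_faithful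
    ⟨vertexIdeal_injective, vertexIdeal_surjective⟩
    (fun j hj => incl_of_idealFunctor_map j hj) (fun _ _ h => le_of_classMap_le h)
    classMap_surjective

/-- The image of `ε(c, d)` under the homomorphism induced by `(F, G)` is `ε(F c, G d)`. -/
theorem connectionFun_idemCone (m : CCMorphism X Y) {c : X.C} (d : {d // d ∈ X.D})
    (h : ConnectedBy c d.1) :
    connectionFun m ⟨_, idemCone_mem d h⟩ = ⟨m.F.obj c, idemCone (m.map_connected d h)⟩ := by
  have e : (⟨c, (idemCone h).star (𝟙 c) inferInstance⟩ : Cone X.C) = ⟨c, idemCone h⟩ :=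
    Cone.ext_comp rfl fun x => by
      show ((idemCone h).comp x ≫ 𝟙 c) ≫ 𝟙 c = _
      rw [Category.comp_id, Category.comp_id]
  have hX := idemCone_mem d h
  rw [← e] at hX
  have e' : (⟨_, idemCone_mem d h⟩ : connectionSemigroup X) = ⟨_, hX⟩ := Subtype.ext e.symm
  rw [e', connectionFun_star m d h (𝟙 c) inferInstance hX]
  refine Cone.ext_comp rfl fun x => ?_
  show ((idemCone (m.map_connected d h)).comp x ≫ m.F.map (𝟙 c)) ≫ 𝟙 _ = _
  rw [m.F.map_id, Category.comp_id, Category.comp_id]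

/-- If a cone represents `f`, then its image under the homomorphism induced by `(F, G)`
represents `F f`. -/
theorem represents_connectionFun (m : CCMorphism X Y) {c c' : X.C} {f : c ⟶ c'}
    {v : connectionSemigroup X} (hv : Represents f v.1) :
    Represents (m.F.map f) (connectionFun m v) := by
  obtain ⟨b, z, d, h, u, hu, hγ⟩ := exists_cone_eq_star v
  obtain ⟨v, hX⟩ := v
  subst hγ
  obtain ⟨k, hk, e⟩ := hv
  rw [connectionFun_star m d h u hu]
  refine ⟨m.F.map k, m.map_incl k hk, ?_⟩
  show ((idemCone (m.map_connected d h)).comp (m.F.obj c) ≫ m.F.map u) ≫ m.F.map k = _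
  rw [← m.map_cone d h, ← m.F.map_comp, ← m.F.map_comp, ← e]
  rfl

theorem mapLObj_vertexIdeal (m : CCMorphism X Y) (c : X.C) :
    mapLObj (connectionHom m) (vertexIdeal c) = vertexIdeal (m.F.obj c) := by
  obtain ⟨d, hd, h⟩ := X.connects c
  rw [vertexIdeal_eq_lobj (idemCone_comp_self h) (idemCone_mem ⟨d, hd⟩ h), mapLObj_lobj,
    vertexIdeal_eq_lobj (idemCone_comp_self (m.map_connected ⟨d, hd⟩ h)) (idemCone_mem _ _)]
  exact congrArg lobj (Subtype.ext (connectionFun_idemCone m ⟨d, hd⟩ h))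

theorem idealFunctor_comp_mapL (m : CCMorphism X Y) :
    m.F ⋙ idealFunctor Y = idealFunctor X ⋙ mapL (connectionHom m) := by
  refine CategoryTheory.Functor.ext (fun c => (mapLObj_vertexIdeal m c).symm) ?_
  intro c c' f
  obtain ⟨v, hv⟩ := exists_represents X f
  refine ev_ext fun γ => ?_
  rw [ev_comp, ev_comp, ev_eqToHom]
  refine (ev_idealFunctor_map (v := connectionHom m v) (represents_connectionFun m hv) γ).trans
    (Eq.trans ?_ (ev_mapL_of_ev (connectionHom m) ((idealFunctor X).map f) v
      (ev_idealFunctor_map hv) _).symm)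
  exact congrArg (fun k => k * _) (ev_eqToHom _ _).symm

theorem classMap_comp (m : CCMorphism X Y) (d : {d // d ∈ X.D}) :
    classMap Y (m.G d) =
      mapClass (connectionSemigroup_leftReductive X) (connectionHom m) (classMap X d) := by
  obtain ⟨c, h⟩ := exists_connectedBy d.1
  have h1 : (classMap X d).1 =
      rClass (principalCone (⟨_, idemCone_mem d h⟩ : connectionSemigroup X)) :=
    classMap_mk (idemCone_spec h).2
  refine Subtype.ext (Eq.trans ?_ (mapClass_mk _ _ _ h1).symm)
  refine classMap_mk ?_
  show rClass (connectionFun m _) = _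
  rw [connectionFun_idemCone]
  exact (idemCone_spec (m.map_connected d h)).2

/-- The connection functor followed by the functor `L` is naturally isomorphic to the identity. -/
noncomputable def counitIso : connectionFunctor.{u} ⋙ leftFunctor.{u} ≅ 𝟭 ConnectedCategory.{u} :=
  (NatIso.ofComponents
    (fun X => (asIso (counitInv X) : X ≅ leftConnected (connectionSemigroup X)))
    (fun m => CCMorphism.ext (idealFunctor_comp_mapL m)
      (OrderHom.ext _ _ (funext fun d => classMap_comp m d))) :
    𝟭 ConnectedCategory.{u} ≅ connectionFunctor.{u} ⋙ leftFunctor.{u}).symm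

end Counit

/-! ### A left reductive regular semigroup and its principal cones -/

section Unit

variable {S T : Type u} [Semigroup S] [Semigroup T] [IsRegularSemigroup S] [IsRegularSemigroup T]

theorem ev_comp_eqToHom {R : Type u} [Semigroup R] {I J K : LObj R} (f : I ⟶ J) (h : J = K) (x : I.carrier) :
    ev (f ≫ eqToHom h) x = ev f x := by
  rw [ev_comp, ev_eqToHom]

/-- The isomorphism `a ↦ r^a` from a left reductive regular semigroup to the connection semigroup
of its connected category. -/
noncomputable def principalEquiv (hS : IsLeftReductive S) :
    S ≃* connectionSemigroup (leftConnected S) :=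
  MulEquiv.ofBijective
    ({ toFun := fun a => ⟨principalCone a, rClass_principalCone_mem a⟩
       map_mul' := fun a b => Subtype.ext (principalCone_mul a b).symm } :
      S →ₙ* connectionSemigroup (leftConnected S))
    ⟨fun _ _ h => principalCone_inj hS (congrArg Subtype.val h), by
      rintro ⟨γ, e, -, h⟩
      obtain ⟨b, -, rfl⟩ := exists_principalCone_of_rLe (rClass_eq.1 h).1
      exact ⟨b, rfl⟩⟩

theorem idemCone_eq_principalCone {f : S} (hf : IsIdempotentElem f) {I : LObj S}
    {d : RClass (Cone (LObj S))} (h : ConnectedBy I d) (hI : I = lobj f)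
    (hd : d = rClass (principalCone f)) : (⟨I, idemCone h⟩ : Cone (LObj S)) = principalCone f := by
  subst hI hd
  exact congrArg (Cone.mk _)
    ((idemCone_spec h).unique (ε' := principalConeTo f) ⟨principalCone_idem hf, rfl⟩)

/-- The homomorphism induced by `(F_φ, G_φ)` sends `r^a` to `r^{φ a}`: for an idempotent `e` in the
`R`-class of `a`, the cone `r^a` is `r^e` followed by the map `x ↦ x a` on `S e`. -/
theorem connectionFun_principalCone (hS : IsLeftReductive S) (φ : S →ₙ* T) (a : S) :
    connectionFun (leftMorphism hS φ) ⟨principalCone a, rClass_principalCone_mem a⟩ =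
      principalCone (φ a) := by
  obtain ⟨e, he, hea⟩ := exists_idem_rClass a
  have hcl : rClass (principalCone e) = rClass (principalCone a) :=
    rClass_eq.2 ⟨principalCone_rLe (rClass_eq.1 hea).1, principalCone_rLe (rClass_eq.1 hea).2⟩
  have h : ConnectedBy (lobj e) (rClass (principalCone a)) :=
    ⟨principalConeTo e, principalCone_idem he, hcl⟩
  let d : {d // d ∈ principalClasses S} := ⟨_, rClass_principalCone_mem a⟩
  let p : lobj e ⟶ lobj a := (principalCone a).comp (lobj e)
  obtain ⟨hp, hcomp⟩ := comp_of_isConnector (principalCone a) (idemCone_spec h)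
  change IsIso p at hp
  have heq : principalCone a = ⟨lobj a, (idemCone h).star p inferInstance⟩ :=
    Cone.ext_comp rfl fun J => (Category.comp_id _).trans (hcomp J)
  have hX := rClass_principalCone_mem a
  rw [heq] at hX
  have h2 : (⟨_, rClass_principalCone_mem a⟩ : connectionSemigroup (leftConnected S)) = ⟨_, hX⟩ :=
    Subtype.ext heq
  rw [h2]
  refine (connectionFun_star (leftMorphism hS φ) d h p hp hX).trans ?_
  have h3 := idemCone_eq_principalCone (he.map φ) ((leftMorphism hS φ).map_connected d h)
    (mapLObj_lobj φ e) (mapClass_mk hS φ d hcl.symm)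
  refine Cone.ext_comp (mapLObj_lobj φ a) fun J => ev_ext fun y => ?_
  refine (ev_comp_eqToHom _ (mapLObj_lobj φ a) y).trans ?_
  refine (ev_mapL_of_ev φ p a (fun _ => rfl) _).trans ?_
  refine (congrArg (fun x => x * φ a) (ev_of_eq_principalCone h3 J y)).trans ?_
  show y.1 * φ e * φ a = y.1 * φ a
  rw [mul_assoc, ← map_mul, IsIdempotentElem.mul_eq_of_rLe he (rClass_eq.1 hea).2]

/-- The functor `L` followed by the connection functor is naturally isomorphic to the identity. -/
noncomputable def unitIso : 𝟭 LRS.{u} ≅ leftFunctor.{u} ⋙ connectionFunctor.{u} :=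
  NatIso.ofComponents
    (fun S => (ObjectProperty.isoMk _ (principalEquiv S.property.2).toSemigrpIso :
      S ≅ connectionLRS (leftConnected S.obj)))
    (fun {S T} φ => by
      ext a : 3
      exact Subtype.ext (connectionFun_principalCone S.property.2 φ.hom.hom a).symm)

end Unit

end CrossConn

theorem theorem3 : ∃ E : CrossConn.LRS.{u} ≌ CrossConn.ConnectedCategory.{u},
    E.functor = CrossConn.leftFunctor.{u} ∧ E.inverse = CrossConn.connectionFunctor.{u} :=
  ⟨CategoryTheory.Equivalence.mk CrossConn.leftFunctor CrossConn.connectionFunctor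
    CrossConn.unitIso CrossConn.counitIso, rfl, rfl⟩
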